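/- Let $n\ge 2$, let $M$ be a smooth $n$-dimensional manifold, let $\alpha=\sqrt{a_{ij}(x)y^iy^j}$ be a Riemannian metric and $\beta=b_i(x)y^i$ a smooth $1$-form on $M$. Write $b_{i|j}$ for the covariant derivative of $\beta$ with respect to $\alpha$, $b(x)=\|\beta_x\|_\alpha$ and $s=\beta/\alpha$. Let $U\subseteq\mathbb R^2$ be open, let $\phi=\phi(b^2,s)$ be a smooth function on $U$, and suppose that $$F=\alpha\,\phi(b^2,s)$$ is a Finsler metric on the set $C$ of all nonzero tangent vectors $y$ with $(b^2,s)\in U$; that is, $F$ is smooth, positive, positively $1$-homogeneous, and $g_{ij}=\tfrac12[F^2]_{y^iy^j}$ is positive definite on $C$. (If $U$ contains all $(b(x)^2,s)$ with $x\in M$, $|s|\le b(x)$, then $C$ consists of all nonzero tangent vectors, and $F$ is a Finsler metric in the usual sense.) If $n=2$, suppose also that for all $x\in M$ and $|s|\le b=b(x)$ with $(b^2,s)\in U$, the set $\{b^2\}\times[s,b]$ or the set $\{b^2\}\times[-b,s]$ is contained in $U$ (which is automatic in the case of a usual Finsler metric). Let $G^i=\frac14 g^{il}\{[F^2]_{x^ky^l}y^k-[F^2]_{x^l}\}$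 be the spray coefficients of $F$ and $B_j{}^i{}_{kl}=\partial^3G^i/\partial y^j\partial y^k\partial y^l$ its Berwald curvature. For a function $\tau$ on $M$, $F$ has isotropic Berwald curvature with factor $\tau$ if on $C$ $$B_j{}^i{}_{kl}=\tau(x)\left(F_{y^jy^k}\delta^i{}_l+F_{y^jy^l}\delta^i{}_k+F_{y^ly^k}\delta^i{}_j+F_{y^jy^ky^l}y^i\right),$$ and $F$ is a Berwald metric if $B_j{}^i{}_{kl}=0$ on $C$. With subscripts $1,2$ denoting derivatives with respect to $b^2$ and $s$, put $$H=\frac{\phi_{22}-2(\phi_1-s\phi_{12})}{2[\phi-s\phi_2+(b^2-s^2)\phi_{22}]},\qquad E=\frac{\phi_2+2s\phi_1}{2\phi}-H\,\frac{s\phi+(b^2-s^2)\phi_2}{\phi}.$$ Assume that $b_{i|j}=c\,a_{ij}$ for a function $c=c(x)$ on $M$ without zeros. Then, for every function $\tau$ on $M$, $F$ has isotropic Berwald curvature with factor $\tau$ if and only if, with $\rho=\tau/c$, $$E-sE_2-\rho(x)(\phi-s\phi_2)=0\quad\text{and}\quad H_2-sH_{22}=0$$ at $(b(x)^2,s)$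 for all $x\in M$ and all $s$ with $|s|\le b(x)$, $(b(x)^2,s)\in U$. In particular, $F$ is a Berwald metric if and only if $E-sE_2=0$ and $H_2-sH_{22}=0$ at all these points. -/

import Mathlib

open scoped Manifold ContDiff

noncomputable section

namespace GeneralAB

/-- The coordinate space of an `n`-dimensional manifold. -/
abbrev Coord (n : ℕ) : Type := EuclideanSpace ℝ (Fin n)

/-- The partial derivative `∂f/∂xⁱ` of a function of coordinates `(x, y)`. -/
def pdx {n : ℕ} (i : Fin n) (f : Coord n → Coord n → ℝ) : Coord n → Coord n → ℝ :=
  fun u y => fderiv ℝ (fun w => f w y) u (EuclideanSpace.single i 1)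

/-- The partial derivative `∂f/∂yⁱ` of a function of coordinates `(x, y)`. -/
def pdy {n : ℕ} (i : Fin n) (f : Coord n → Coord n → ℝ) : Coord n → Coord n → ℝ :=
  fun u y => fderiv ℝ (f u) y (EuclideanSpace.single i 1)

/-! ### Finsler geometry in coordinates

Here `F : Coord n → Coord n → ℝ` is the coordinate expression `F(x, y)` of a function on the
tangent bundle. -/

/-- The fundamental tensor `g_{ij} = ½ [F²]_{yⁱ yʲ}`. -/
def fundamentalTensor {n : ℕ} (F : Coord n → Coord n → ℝ) (u y : Coord n) :
    Matrix (Fin n) (Fin n) ℝ :=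
  Matrix.of fun i j => (1 / 2) * pdy j (pdy i (fun u y => F u y ^ 2)) u y

/-- The spray coefficients `Gⁱ = ¼ g^{il} ([F²]_{xᵏ yˡ} yᵏ - [F²]_{xˡ})`. -/
def spray {n : ℕ} (F : Coord n → Coord n → ℝ) (i : Fin n) (u y : Coord n) : ℝ :=
  (1 / 4) * ∑ l, (fundamentalTensor F u y)⁻¹ i l *
    ((∑ k, pdx k (pdy l (fun u y => F u y ^ 2)) u y * y k) - pdx l (fun u y => F u y ^ 2) u y)

/-- The Berwald curvature `B_j^i_{kl} = ∂³Gⁱ / ∂yʲ ∂yᵏ ∂yˡ`. -/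
def berwald {n : ℕ} (F : Coord n → Coord n → ℝ) (j i k l : Fin n) (u y : Coord n) : ℝ :=
  pdy l (pdy k (pdy j (spray F i))) u y

/-- `F_{yʲyᵏ} δⁱ_l + F_{yʲyˡ} δⁱ_k + F_{yˡyᵏ} δⁱ_j + F_{yʲyᵏyˡ} yⁱ`. -/
def isotropicTensor {n : ℕ} (F : Coord n → Coord n → ℝ) (j i k l : Fin n) (u y : Coord n) : ℝ :=
  pdy k (pdy j F) u y * (if i = l then 1 else 0)
    + pdy l (pdy j F) u y * (if i = k then 1 else 0)
    + pdy k (pdy l F) u y * (if i = j then 1 else 0)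
    + pdy l (pdy k (pdy j F)) u y * y i

section Manifold

variable {n : ℕ} {M : Type*} [TopologicalSpace M] [ChartedSpace (Coord n) M]

/-- The tangent vector `yⁱ ∂/∂xⁱ` at the point with coordinates `u` in the chart `e`. -/
def chartVec (e : OpenPartialHomeomorph M (Coord n)) (u y : Coord n) :
    TangentBundle (𝓡 n) M :=
  ⟨e.symm u, mfderiv 𝓘(ℝ, Coord n) (𝓡 n) e.symm u y⟩

/-- The expression `F(x, y)`, in the coordinates induced by the chart `e`, of a function `F` on
the tangent bundle. -/
def inChart (e : OpenPartialHomeomorph M (Coord n)) (F : TangentBundle (𝓡 n) M → ℝ) :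
    Coord n → Coord n → ℝ :=
  fun u y => F (chartVec e u y)

variable [IsManifold (𝓡 n) ∞ M]

/-- `F` is a Finsler metric with domain `C`, an open cone bundle of nonzero tangent vectors.
For `C` the set of all nonzero tangent vectors this is a Finsler metric in the usual (regular)
sense; smaller `C` allow singular metrics such as Kropina metrics. -/
structure IsFinslerOn (C : Set (TangentBundle (𝓡 n) M)) (F : TangentBundle (𝓡 n) M → ℝ) :
    Prop where
  isOpen : IsOpen C
  ne_zero : ∀ p ∈ C, p.2 ≠ 0
  cone : ∀ (x : M) (v : TangentSpace (𝓡 n) x) (r : ℝ), 0 < r →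
    (⟨x, v⟩ : TangentBundle (𝓡 n) M) ∈ C → (⟨x, r • v⟩ : TangentBundle (𝓡 n) M) ∈ C
  smooth : ContMDiffOn (𝓡 n).tangent 𝓘(ℝ, ℝ) ∞ F C
  pos : ∀ p ∈ C, 0 < F p
  homogeneous : ∀ (x : M) (v : TangentSpace (𝓡 n) x) (r : ℝ), 0 < r →
    (⟨x, v⟩ : TangentBundle (𝓡 n) M) ∈ C → F ⟨x, r • v⟩ = r * F ⟨x, v⟩
  posDef : ∀ e ∈ IsManifold.maximalAtlas (𝓡 n) ∞ M, ∀ u ∈ e.target, ∀ y : Coord n,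
    chartVec e u y ∈ C → (fundamentalTensor (inChart e F) u y).PosDef

/-- `F` has isotropic Berwald curvature on `C` with factor `τ`:
`B_j^i_{kl} = τ(x) (F_{yʲyᵏ} δⁱ_l + F_{yʲyˡ} δⁱ_k + F_{yˡyᵏ} δⁱ_j + F_{yʲyᵏyˡ} yⁱ)`. -/
def HasIsotropicBerwaldCurvature (C : Set (TangentBundle (𝓡 n) M))
    (F : TangentBundle (𝓡 n) M → ℝ) (τ : M → ℝ) : Prop :=
  ∀ e ∈ IsManifold.maximalAtlas (𝓡 n) ∞ M, ∀ u ∈ e.target, ∀ y : Coord n,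
    chartVec e u y ∈ C → ∀ j i k l : Fin n,
      berwald (inChart e F) j i k l u y = τ (e.symm u) * isotropicTensor (inChart e F) j i k l u y

/-- `F` is a Berwald metric on `C`: its Berwald curvature vanishes. -/
def IsBerwald (C : Set (TangentBundle (𝓡 n) M)) (F : TangentBundle (𝓡 n) M → ℝ) : Prop :=
  ∀ e ∈ IsManifold.maximalAtlas (𝓡 n) ∞ M, ∀ u ∈ e.target, ∀ y : Coord n,
    chartVec e u y ∈ C → ∀ j i k l : Fin n, berwald (inChart e F) j i k l u y = 0

/-! ### The Riemannian metric and the 1-form -/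

variable (n M) in
/-- Smooth Riemannian metrics on `M`. -/
abbrev RiemMetric :=
  Bundle.ContMDiffRiemannianMetric (𝓡 n) ∞ (Coord n) (fun x : M => TangentSpace (𝓡 n) x)

variable (n M) in
/-- Smooth 1-forms on `M`. -/
structure OneForm where
  form (x : M) : TangentSpace (𝓡 n) x →L[ℝ] ℝ
  contMDiff : ContMDiff (𝓡 n) ((𝓡 n).prod 𝓘(ℝ, Coord n →L[ℝ] ℝ)) ∞
    (fun x => (Bundle.TotalSpace.mk' (Coord n →L[ℝ] ℝ) x (form x) :
      Bundle.TotalSpace (Coord n →L[ℝ] ℝ)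
        (fun x : M => TangentSpace (𝓡 n) x →L[ℝ] Bundle.Trivial M ℝ x)))

/-- The components `a_{ij}` of the Riemannian metric in the chart `e`. -/
def metricCoeff (a : RiemMetric n M) (e : OpenPartialHomeomorph M (Coord n)) (u : Coord n) :
    Matrix (Fin n) (Fin n) ℝ :=
  Matrix.of fun i j => a.inner (e.symm u)
    (chartVec e u (EuclideanSpace.single i 1)).2 (chartVec e u (EuclideanSpace.single j 1)).2

/-- The components `b_i` of the 1-form in the chart `e`. -/
def formCoeff (β : OneForm n M) (e : OpenPartialHomeomorph M (Coord n)) (u : Coord n)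
    (i : Fin n) : ℝ :=
  β.form (e.symm u) (chartVec e u (EuclideanSpace.single i 1)).2

/-- The Christoffel symbols `Γᵏ_{ij} = ½ a^{kl} (∂_i a_{lj} + ∂_j a_{li} - ∂_l a_{ij})`. -/
def christoffel (a : RiemMetric n M) (e : OpenPartialHomeomorph M (Coord n)) (u : Coord n)
    (k i j : Fin n) : ℝ :=
  let D (m p q : Fin n) : ℝ :=
    fderiv ℝ (fun w => metricCoeff a e w p q) u (EuclideanSpace.single m 1)
  (1 / 2) * ∑ l, (metricCoeff a e u)⁻¹ k l * (D i l j + D j l i - D l i j)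

/-- The covariant derivative `b_{i|j} = ∂_j b_i - Γᵏ_{ij} b_k` of the 1-form with respect to the
Riemannian metric. -/
def covDeriv (a : RiemMetric n M) (β : OneForm n M) (e : OpenPartialHomeomorph M (Coord n))
    (u : Coord n) (i j : Fin n) : ℝ :=
  fderiv ℝ (fun w => formCoeff β e w i) u (EuclideanSpace.single j 1)
    - ∑ k, christoffel a e u k i j * formCoeff β e u k

/-- `α(x, v) = √(a_{ij} vⁱ vʲ)`. -/
def alpha (a : RiemMetric n M) (p : TangentBundle (𝓡 n) M) : ℝ :=
  √(a.inner p.1 p.2 p.2)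

/-- `b(x) = ‖β_x‖_α`, the dual norm of `β_x`. -/
def normForm (a : RiemMetric n M) (β : OneForm n M) (x : M) : ℝ :=
  sSup {t : ℝ | ∃ v : TangentSpace (𝓡 n) x, alpha a ⟨x, v⟩ ≤ 1 ∧ t = |β.form x v|}

/-- `s = β / α`. -/
def sVar (a : RiemMetric n M) (β : OneForm n M) (p : TangentBundle (𝓡 n) M) : ℝ :=
  β.form p.1 p.2 / alpha a p

/-- `F = α φ(b², s)`. -/
def generalAB (a : RiemMetric n M) (β : OneForm n M) (φ : ℝ → ℝ → ℝ)
    (p : TangentBundle (𝓡 n) M) : ℝ :=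
  alpha a p * φ (normForm a β p.1 ^ 2) (sVar a β p)

/-- The domain of `F = α φ(b², s)` when `φ` is defined on `U`: the nonzero tangent vectors with
`(b², s) ∈ U`. -/
def domainAB (a : RiemMetric n M) (β : OneForm n M) (U : Set (ℝ × ℝ)) :
    Set (TangentBundle (𝓡 n) M) :=
  {p | p.2 ≠ 0 ∧ (normForm a β p.1 ^ 2, sVar a β p) ∈ U}

end Manifold

/-! ### The functions `E` and `H`

Functions of `(t, s)`, with `t` standing for `b²`. -/

/-- The derivative with respect to the first variable, `b²`. -/
def D1 (f : ℝ → ℝ → ℝ) : ℝ → ℝ → ℝ := fun t s => deriv (fun r => f r s) t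

/-- The derivative with respect to the second variable, `s`. -/
def D2 (f : ℝ → ℝ → ℝ) : ℝ → ℝ → ℝ := fun t s => deriv (f t) s

/-- `H = (φ₂₂ - 2(φ₁ - s φ₁₂)) / (2 [φ - s φ₂ + (b² - s²) φ₂₂])`. -/
def Hfun (φ : ℝ → ℝ → ℝ) : ℝ → ℝ → ℝ := fun t s =>
  (D2 (D2 φ) t s - 2 * (D1 φ t s - s * D2 (D1 φ) t s)) /
    (2 * (φ t s - s * D2 φ t s + (t - s ^ 2) * D2 (D2 φ) t s))

/-- `E = (φ₂ + 2 s φ₁) / (2 φ) - H (s φ + (b² - s²) φ₂) / φ`. -/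
def Efun (φ : ℝ → ℝ → ℝ) : ℝ → ℝ → ℝ := fun t s =>
  (D2 φ t s + 2 * s * D1 φ t s) / (2 * φ t s)
    - Hfun φ t s * ((s * φ t s + (t - s ^ 2) * D2 φ t s) / φ t s)

end GeneralAB

end

/-!
The proof is a computation of the spray of `F = α φ(b², s)` followed by the solution of two
ordinary differential equations in `s`.

*The spray.* In a chart, `F² = A φ(t, B / √A)²` is a function `lag φ` of `t = b²`, `A = α²` and
`B = β`. If `b_{i|j} = c a_{ij}`, then `β` is closed and `∂_k b² = 2 c b_k` (`fderiv_normSq`), so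
all first derivatives of the coefficients are expressed through the Christoffel symbols, and
solving the linear system `g_{il} Gˡ = ¼ ([F²]_{xᵏ yⁱ} yᵏ - [F²]_{xⁱ})` gives (`spray_eq`)
`Gⁱ = Gⁱ_α + c (α E yⁱ + α² H bⁱ)`. The denominators of `E` and `H` do not vanish because the
fundamental tensor is positive definite (`denom_pos`). Since `Gⁱ_α` is quadratic in `y`, and the
isotropic tensor consists of the third derivatives of `F yⁱ`, the curvature is isotropic with
factor `τ` exactly when the third `y`-derivatives of `α f(s) yⁱ + α² h(s) bⁱ` (`abField`) vanish,
where `f = E - ρ φ` and `h = H` (`berwald_sub_isotropicTensor`).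

*Sufficiency.* On an interval, `f = s f'` and `h' = s h''` force `f = l s` and `h = m + k s²`, so
that `α f yⁱ + α² h bⁱ = l β yⁱ + (m α² + k β²) bⁱ` is quadratic in `y` (`dyyy_abField_eq_zero`).

*Necessity.* If the third derivatives vanish, the Hessian of each component is constant along any
path in the domain, and by Euler's theorem each component is given by a fixed quadratic form along
the path (`exists_eq_qf_of_dyyy_eq_zero`). Take the path `cos θ y₀ + sin θ v`, where `y₀` and `v`
are orthonormal and `v` is also orthogonal to `b`. Along it `s = β(y₀) cos θ` is even in `θ`.
Comparing the values at `θ` and `-θ` of the pairings of the field with `v` and with `b` shows that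
`f` is linear in `s` and that `h` is a polynomial `m + k s²` (`eq_on_arc`). For `n ≥ 3` there is
such a `v` for each `y₀`, and a short arc suffices if `s ≠ 0`; the equations at `s = 0` are a
limit. For `n = 2` only `y₀` parallel to `b` has one, and the arc from it has to stay in the domain
until it reaches the given `s`; this is the role of the additional hypothesis on `U`
(`ode_of_dyyy_eq_zero`).

*Zeros of `β`.* Where `b = 0`, the only value is `s = 0`; the first equation `f(0) = 0` still
follows from an arc (`eq_zero_of_dyyy_eq_zero`), but the second, `H₂ = 0`, is not visible in the
field at that point. It follows by continuity from the nearby points, because `β` cannot vanish on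
an open set when `b_{i|j} = c a_{ij}` with `c ≠ 0`.
-/

noncomputable section

namespace GeneralAB

/-! ### Calculus of `F²` as a function of `b²`, `α²` and `β` -/

theorem hasFDerivAt_uncurry {f : ℝ → ℝ → ℝ} {t s : ℝ}
    (h : DifferentiableAt ℝ (Function.uncurry f) (t, s)) :
    HasFDerivAt (Function.uncurry f)
      (D1 f t s • ContinuousLinearMap.fst ℝ ℝ ℝ + D2 f t s • ContinuousLinearMap.snd ℝ ℝ ℝ)
      (t, s) := by
  have h0 := h.hasFDerivAt
  have h1 : D1 f t s = fderiv ℝ (Function.uncurry f) (t, s) (1, 0) := by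
    have : HasDerivAt (fun r => (r, s)) ((1 : ℝ), (0 : ℝ)) t :=
      (hasDerivAt_id t).prodMk (hasDerivAt_const t s)
    exact (h0.comp_hasDerivAt t this).deriv
  have h2 : D2 f t s = fderiv ℝ (Function.uncurry f) (t, s) (0, 1) := by
    have : HasDerivAt (fun r => (t, r)) ((0 : ℝ), (1 : ℝ)) s :=
      (hasDerivAt_const s t).prodMk (hasDerivAt_id s)
    exact (h0.comp_hasDerivAt s this).deriv
  convert h0 using 1
  ext <;> simp [h1, h2]

theorem contDiffOn_D1 {f : ℝ → ℝ → ℝ} {U : Set (ℝ × ℝ)} (hU : IsOpen U)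
    (hf : ContDiffOn ℝ ∞ (Function.uncurry f) U) :
    ContDiffOn ℝ ∞ (Function.uncurry (D1 f)) U := by
  have h := (hf.fderiv_of_isOpen hU (m := ∞) le_rfl).clm_apply
    (contDiffOn_const (c := ((1 : ℝ), (0 : ℝ))))
  refine h.congr fun p hp => ?_
  have hd := (hf.differentiableOn (by simp)).differentiableAt (hU.mem_nhds hp)
  rw [(hasFDerivAt_uncurry (t := p.1) (s := p.2) hd).fderiv]
  simp [Function.uncurry]

theorem contDiffOn_D2 {f : ℝ → ℝ → ℝ} {U : Set (ℝ × ℝ)} (hU : IsOpen U)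
    (hf : ContDiffOn ℝ ∞ (Function.uncurry f) U) :
    ContDiffOn ℝ ∞ (Function.uncurry (D2 f)) U := by
  have h := (hf.fderiv_of_isOpen hU (m := ∞) le_rfl).clm_apply
    (contDiffOn_const (c := ((0 : ℝ), (1 : ℝ))))
  refine h.congr fun p hp => ?_
  have hd := (hf.differentiableOn (by simp)).differentiableAt (hU.mem_nhds hp)
  rw [(hasFDerivAt_uncurry (t := p.1) (s := p.2) hd).fderiv]
  simp [Function.uncurry]

theorem D1_D2_comm {f : ℝ → ℝ → ℝ} {U : Set (ℝ × ℝ)} (hU : IsOpen U)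
    (hf : ContDiffOn ℝ ∞ (Function.uncurry f) U) {t s : ℝ} (h : (t, s) ∈ U) :
    D1 (D2 f) t s = D2 (D1 f) t s := by
  have hd : ∀ p ∈ U, DifferentiableAt ℝ (Function.uncurry f) p := fun p hp =>
    (hf.differentiableOn (by simp)).differentiableAt (hU.mem_nhds hp)
  have hsymm : IsSymmSndFDerivAt ℝ (Function.uncurry f) (t, s) :=
    (hf.contDiffAt (hU.mem_nhds h)).isSymmSndFDerivAt (by
      rw [minSmoothness_of_isRCLikeNormedField]; exact WithTop.coe_le_coe.2 le_top)
  have hdd : DifferentiableAt ℝ (fderiv ℝ (Function.uncurry f)) (t, s) :=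
    ((hf.fderiv_of_isOpen hU (m := ∞) le_rfl).differentiableOn (by simp)).differentiableAt
      (hU.mem_nhds h)
  have e1 : Function.uncurry (D1 f) =ᶠ[nhds (t, s)]
      fun p => fderiv ℝ (Function.uncurry f) p (1, 0) := by
    filter_upwards [hU.mem_nhds h] with p hp
    rw [(hasFDerivAt_uncurry (t := p.1) (s := p.2) (hd p hp)).fderiv]
    simp [Function.uncurry]
  have e2 : Function.uncurry (D2 f) =ᶠ[nhds (t, s)]
      fun p => fderiv ℝ (Function.uncurry f) p (0, 1) := by
    filter_upwards [hU.mem_nhds h] with p hp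
    rw [(hasFDerivAt_uncurry (t := p.1) (s := p.2) (hd p hp)).fderiv]
    simp [Function.uncurry]
  have k1 : HasFDerivAt (fun p => fderiv ℝ (Function.uncurry f) p (1, 0)) _ (t, s) :=
    hdd.hasFDerivAt.clm_apply (hasFDerivAt_const ((1 : ℝ), (0 : ℝ)) _)
  have k2 : HasFDerivAt (fun p => fderiv ℝ (Function.uncurry f) p (0, 1)) _ (t, s) :=
    hdd.hasFDerivAt.clm_apply (hasFDerivAt_const ((0 : ℝ), (1 : ℝ)) _)
  have d1 := (contDiffOn_D1 hU hf).differentiableOn (by simp) |>.differentiableAt (hU.mem_nhds h)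
  have d2 := (contDiffOn_D2 hU hf).differentiableOn (by simp) |>.differentiableAt (hU.mem_nhds h)
  have q1 := congrArg (fun l => l ((0 : ℝ), (1 : ℝ)))
    ((hasFDerivAt_uncurry d1).unique (k1.congr_of_eventuallyEq e1))
  have q2 := congrArg (fun l => l ((1 : ℝ), (0 : ℝ)))
    ((hasFDerivAt_uncurry d2).unique (k2.congr_of_eventuallyEq e2))
  simp at q1 q2
  rw [q1, q2]
  exact hsymm _ _

/-- The linear functional on `ℝ³` with the given coefficients, used for the derivatives of functions
of `(b², α², β)`. -/
def grad3 (x y z : ℝ) : ℝ × ℝ × ℝ →L[ℝ] ℝ :=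
  x • ContinuousLinearMap.fst ℝ ℝ (ℝ × ℝ)
    + y • (ContinuousLinearMap.fst ℝ ℝ ℝ ∘L ContinuousLinearMap.snd ℝ ℝ (ℝ × ℝ))
    + z • (ContinuousLinearMap.snd ℝ ℝ ℝ ∘L ContinuousLinearMap.snd ℝ ℝ (ℝ × ℝ))

@[simp] theorem grad3_apply (x y z : ℝ) (p : ℝ × ℝ × ℝ) :
    grad3 x y z p = x * p.1 + y * p.2.1 + z * p.2.2 := by
  simp [grad3]

theorem hasFDerivAt_first (p : ℝ × ℝ × ℝ) :
    HasFDerivAt (fun p : ℝ × ℝ × ℝ => p.1) (grad3 1 0 0) p :=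
  hasFDerivAt_fst.congr_fderiv (by ext <;> simp)

theorem hasFDerivAt_second (p : ℝ × ℝ × ℝ) :
    HasFDerivAt (fun p : ℝ × ℝ × ℝ => p.2.1) (grad3 0 1 0) p :=
  hasFDerivAt_snd.fst.congr_fderiv (by ext <;> simp)

theorem hasFDerivAt_third (p : ℝ × ℝ × ℝ) :
    HasFDerivAt (fun p : ℝ × ℝ × ℝ => p.2.2) (grad3 0 0 1) p :=
  hasFDerivAt_snd.snd.congr_fderiv (by ext <;> simp)

/-- `F² = A φ(t, B / √A)²` as a function of `t = b²`, `A = α²` and `B = β`. -/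
def lag (φ : ℝ → ℝ → ℝ) (p : ℝ × ℝ × ℝ) : ℝ := p.2.1 * φ p.1 (p.2.2 / √p.2.1) ^ 2

/-- The derivative of `lag φ` with respect to `A = α²`, which is `φ² - s φ φ₂` at `s = B / √A`. -/
def lagA (φ : ℝ → ℝ → ℝ) (p : ℝ × ℝ × ℝ) : ℝ :=
  φ p.1 (p.2.2 / √p.2.1) ^ 2
    - p.2.2 / √p.2.1 * (φ p.1 (p.2.2 / √p.2.1) * D2 φ p.1 (p.2.2 / √p.2.1))

/-- The derivative of `lag φ` with respect to `B = β`, which is `2 α φ φ₂`. -/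
def lagB (φ : ℝ → ℝ → ℝ) (p : ℝ × ℝ × ℝ) : ℝ :=
  2 * √p.2.1 * (φ p.1 (p.2.2 / √p.2.1) * D2 φ p.1 (p.2.2 / √p.2.1))

/-- The derivative of `s = B / √A`. -/
theorem hasFDerivAt_ratio {p : ℝ × ℝ × ℝ} (hp : 0 < p.2.1) :
    HasFDerivAt (fun p : ℝ × ℝ × ℝ => p.2.2 / √p.2.1)
      (grad3 0 (-(p.2.2 / √p.2.1) / (2 * √p.2.1 ^ 2)) (1 / √p.2.1)) p := by
  have h1 := hasFDerivAt_second p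
  have h2 := hasFDerivAt_third p
  have hs : 0 < √p.2.1 := Real.sqrt_pos.2 hp
  have h3 := h2.mul ((hasDerivAt_inv hs.ne').comp_hasFDerivAt p (h1.sqrt hp.ne'))
  simp only [Function.comp_def] at h3
  refine (h3.congr_of_eventuallyEq (.of_forall fun q => by simp [div_eq_mul_inv])).congr_fderiv ?_
  ext <;> simp; field_simp

theorem hasFDerivAt_comp_ratio {f : ℝ → ℝ → ℝ} {p : ℝ × ℝ × ℝ} (hp : 0 < p.2.1)
    (hf : DifferentiableAt ℝ (Function.uncurry f) (p.1, p.2.2 / √p.2.1)) :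
    HasFDerivAt (fun p : ℝ × ℝ × ℝ => f p.1 (p.2.2 / √p.2.1))
      (grad3 (D1 f p.1 (p.2.2 / √p.2.1))
        (D2 f p.1 (p.2.2 / √p.2.1) * (-(p.2.2 / √p.2.1) / (2 * √p.2.1 ^ 2)))
        (D2 f p.1 (p.2.2 / √p.2.1) * (1 / √p.2.1))) p := by
  have h1 := hasFDerivAt_first p
  refine ((hasFDerivAt_uncurry hf).comp p (h1.prodMk (hasFDerivAt_ratio hp))).congr_fderiv ?_
  ext <;> simp

section
variable {φ : ℝ → ℝ → ℝ} {U : Set (ℝ × ℝ)} (hU : IsOpen U)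
  (hφ : ContDiffOn ℝ ∞ (Function.uncurry φ) U) {p : ℝ × ℝ × ℝ} (hp : 0 < p.2.1)
  (hpU : (p.1, p.2.2 / √p.2.1) ∈ U) {t s α f f1 f2 f12 f22 : ℝ}
  (ht : t = p.1) (hα : α = √p.2.1) (hs : s = p.2.2 / √p.2.1)
  (hf : f = φ t s) (hf1 : f1 = D1 φ t s) (hf2 : f2 = D2 φ t s) (hf12 : f12 = D2 (D1 φ) t s)
  (hf22 : f22 = D2 (D2 φ) t s)
include hU hφ hp hpU ht hα hs hf hf1 hf2

theorem hasFDerivAt_lag :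
    HasFDerivAt (lag φ) (grad3 (2 * α ^ 2 * (f * f1)) (lagA φ p) (lagB φ p)) p := by
  have hd := (hφ.differentiableOn (by simp)).differentiableAt (hU.mem_nhds hpU)
  have h1 := hasFDerivAt_second p
  refine (h1.mul ((hasFDerivAt_comp_ratio hp hd).pow 2)).congr_fderiv ?_
  have hq : p.2.1 = α ^ 2 := by rw [hα, Real.sq_sqrt hp.le]
  have h0 : 0 < α := hα ▸ Real.sqrt_pos.2 hp
  unfold lagA lagB
  rw [← hs, ← hα, ← ht, ← hf, ← hf1, ← hf2, hq]
  ext <;> simp <;> field_simp; ring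

include hf12 hf22

theorem hasFDerivAt_lagA :
    HasFDerivAt (lagA φ) (grad3 (2 * (f * f1) - s * (f1 * f2 + f * f12))
      (-s / (2 * α ^ 2) * (f * f2 - s * (f2 ^ 2 + f * f22)))
      ((f * f2 - s * (f2 ^ 2 + f * f22)) / α)) p := by
  have hd := (hφ.differentiableOn (by simp)).differentiableAt (hU.mem_nhds hpU)
  have hd2 := ((contDiffOn_D2 hU hφ).differentiableOn (by simp)).differentiableAt
    (hU.mem_nhds hpU)
  have hc := D1_D2_comm hU hφ hpU
  refine (((hasFDerivAt_comp_ratio hp hd).pow 2).sub ((hasFDerivAt_ratio hp).mul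
    ((hasFDerivAt_comp_ratio hp hd).mul (hasFDerivAt_comp_ratio hp hd2)))).congr_fderiv ?_
  have h0 : 0 < α := hα ▸ Real.sqrt_pos.2 hp
  simp only [Pi.mul_apply]
  rw [hc]
  rw [← hs, ← hα, ← ht, ← hf, ← hf1, ← hf2, ← hf12, ← hf22]
  ext <;> simp <;> field_simp <;> ring

theorem hasFDerivAt_lagB :
    HasFDerivAt (lagB φ) (grad3 (2 * α * (f1 * f2 + f * f12))
      ((f * f2 - s * (f2 ^ 2 + f * f22)) / α) (2 * (f2 ^ 2 + f * f22))) p := by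
  have hd := (hφ.differentiableOn (by simp)).differentiableAt (hU.mem_nhds hpU)
  have hd2 := ((contDiffOn_D2 hU hφ).differentiableOn (by simp)).differentiableAt
    (hU.mem_nhds hpU)
  have hc := D1_D2_comm hU hφ hpU
  have h1 := hasFDerivAt_second p
  refine (((h1.sqrt hp.ne').const_mul 2).mul
    ((hasFDerivAt_comp_ratio hp hd).mul (hasFDerivAt_comp_ratio hp hd2))).congr_fderiv ?_
  have h0 : 0 < α := hα ▸ Real.sqrt_pos.2 hp
  simp only [Pi.mul_apply]
  rw [hc]
  rw [← hs, ← hα, ← ht, ← hf, ← hf1, ← hf2, ← hf12, ← hf22]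
  ext <;> simp <;> field_simp <;> ring

end

/-! ### Quadratic and linear forms, Christoffel symbols, contractions -/

section

variable {n : ℕ}

/-- The quadratic form `∑ M_{ij} yⁱ yʲ`. -/
def qf (M : Matrix (Fin n) (Fin n) ℝ) (y : Coord n) : ℝ := ∑ i, ∑ j, M i j * (y i * y j)

/-- The linear form `∑ b_i yⁱ`. -/
def lf (b : Fin n → ℝ) (y : Coord n) : ℝ := ∑ i, b i * y i

/-- The covector `∑ M_{lj} yʲ`. -/
def lower (M : Matrix (Fin n) (Fin n) ℝ) (y : Coord n) (l : Fin n) : ℝ := ∑ j, M l j * y j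

theorem hasFDerivAt_coord (i : Fin n) (y : Coord n) :
    HasFDerivAt (fun y : Coord n => y i) (EuclideanSpace.proj i : Coord n →L[ℝ] ℝ) y :=
  (EuclideanSpace.proj i : Coord n →L[ℝ] ℝ).hasFDerivAt

theorem hasFDerivAt_qf (M : Matrix (Fin n) (Fin n) ℝ) (y : Coord n) :
    HasFDerivAt (qf M) (∑ i, ∑ j, M i j • (y i • (EuclideanSpace.proj j : Coord n →L[ℝ] ℝ)
      + y j • (EuclideanSpace.proj i : Coord n →L[ℝ] ℝ))) y :=
  HasFDerivAt.fun_sum fun i _ => HasFDerivAt.fun_sum fun j _ =>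
    ((hasFDerivAt_coord i y).mul (hasFDerivAt_coord j y)).const_mul (M i j)

theorem hasFDerivAt_lf (b : Fin n → ℝ) (y : Coord n) :
    HasFDerivAt (lf b) (∑ i, b i • (EuclideanSpace.proj i : Coord n →L[ℝ] ℝ)) y :=
  HasFDerivAt.fun_sum fun i _ => (hasFDerivAt_coord i y).const_mul (b i)

theorem fderiv_qf_single {M : Matrix (Fin n) (Fin n) ℝ} (hM : M.IsSymm) (y : Coord n)
    (l : Fin n) : fderiv ℝ (qf M) y (EuclideanSpace.single l 1) = 2 * lower M y l := by
  rw [(hasFDerivAt_qf M y).fderiv]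
  simp [Finset.sum_add_distrib, lower, two_mul]
  exact Finset.sum_congr rfl fun i _ => by rw [hM.apply]

theorem fderiv_lf_single (b : Fin n → ℝ) (y : Coord n) (l : Fin n) :
    fderiv ℝ (lf b) y (EuclideanSpace.single l 1) = b l := by
  rw [(hasFDerivAt_lf b y).fderiv]
  simp

theorem qf_eq_lf_lower (M : Matrix (Fin n) (Fin n) ℝ) (y : Coord n) :
    qf M y = lf (lower M y) y := by
  unfold qf lf lower
  refine Finset.sum_congr rfl fun i _ => ?_
  rw [Finset.sum_mul]
  exact Finset.sum_congr rfl fun j _ => by ring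

/-- The Christoffel symbols of a matrix-valued function of the coordinates. -/
def chr (a : Coord n → Matrix (Fin n) (Fin n) ℝ) (u : Coord n) (k i j : Fin n) : ℝ :=
  let D (m p q : Fin n) : ℝ := fderiv ℝ (fun w => a w p q) u (EuclideanSpace.single m 1)
  (1 / 2) * ∑ l, (a u)⁻¹ k l * (D i l j + D j l i - D l i j)

/-- The vector `∑ Γᵐ_{ij} yⁱ yʲ`, twice the spray of the Riemannian metric. -/
def chrSpray (a : Coord n → Matrix (Fin n) (Fin n) ℝ) (u y : Coord n) (m : Fin n) : ℝ :=
  qf (Matrix.of fun i j => chr a u m i j) y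

/-- The partial derivative `∂_k a_{ij}`. -/
def da (a : Coord n → Matrix (Fin n) (Fin n) ℝ) (u : Coord n) (k i j : Fin n) : ℝ :=
  fderiv ℝ (fun w => a w i j) u (EuclideanSpace.single k 1)

/-- The partial derivative `∂_k b_i`. -/
def db (b : Coord n → Fin n → ℝ) (u : Coord n) (k i : Fin n) : ℝ :=
  fderiv ℝ (fun w => b w i) u (EuclideanSpace.single k 1)

theorem chr_symm {a : Coord n → Matrix (Fin n) (Fin n) ℝ} {u : Coord n}
    (hsymm : ∀ k i j, da a u k i j = da a u k j i) (k i j : Fin n) :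
    chr a u k i j = chr a u k j i := by
  unfold da at hsymm
  simp only [chr]
  congr 1
  refine Finset.sum_congr rfl fun l _ => ?_
  rw [hsymm l i j]; ring

/-- Lowering the upper index of the Christoffel symbols gives those of the first kind. -/
theorem sum_mul_chr {a : Coord n → Matrix (Fin n) (Fin n) ℝ} {u : Coord n}
    (hdet : IsUnit (a u).det) (l i j : Fin n) :
    ∑ m, a u l m * chr a u m i j = (1 / 2) * (da a u i l j + da a u j l i - da a u l i j) := by
  have h1 : (fun m => chr a u m i j) = (1 / 2 : ℝ) • ((a u)⁻¹).mulVec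
      (fun l => da a u i l j + da a u j l i - da a u l i j) := by
    funext m
    simp [chr, Matrix.mulVec, dotProduct, da]
  have h2 : ∑ m, a u l m * chr a u m i j = (a u).mulVec (fun m => chr a u m i j) l := by
    simp [Matrix.mulVec, dotProduct]
  rw [h2, h1, Matrix.mulVec_smul, Matrix.mulVec_mulVec, Matrix.mul_nonsing_inv _ hdet]
  simp

section contraction
variable {a : Coord n → Matrix (Fin n) (Fin n) ℝ} {b : Coord n → Fin n → ℝ} {u : Coord n}
  {c : ℝ} (y : Coord n)

/-- `a(G, ·)` for `G = chrSpray`, in terms of the first derivatives of the metric. -/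
theorem lower_chrSpray (hdet : IsUnit (a u).det) (l : Fin n) :
    lf (a u l) (WithLp.toLp 2 (chrSpray a u y))
      = (∑ k, lower (Matrix.of (da a u k)) y l * y k)
        - (1 / 2) * qf (Matrix.of (da a u l)) y := by
  have h1 : lf (a u l) (WithLp.toLp 2 (chrSpray a u y))
      = ∑ i, ∑ j, (∑ m, a u l m * chr a u m i j) * (y i * y j) := by
    simp only [lf, chrSpray, qf, Matrix.of_apply, Finset.mul_sum, Finset.sum_mul]
    rw [Finset.sum_comm]
    refine Finset.sum_congr rfl fun i _ => ?_
    rw [Finset.sum_comm]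
    exact Finset.sum_congr rfl fun j _ => Finset.sum_congr rfl fun m _ => by ring
  have h2 : ∑ i, ∑ j, da a u i l j * (y i * y j) = ∑ k, ∑ j, da a u k l j * y j * y k :=
    Finset.sum_congr rfl fun i _ => Finset.sum_congr rfl fun j _ => by ring
  have h3 : ∑ i, ∑ j, da a u j l i * (y i * y j) = ∑ k, ∑ j, da a u k l j * y j * y k := by
    rw [Finset.sum_comm]
    exact Finset.sum_congr rfl fun i _ => Finset.sum_congr rfl fun j _ => by ring
  have h4 : ∑ i, ∑ j, (1 / 2) * (da a u i l j + da a u j l i - da a u l i j) * (y i * y j)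
      = (1 / 2) * ((∑ i, ∑ j, da a u i l j * (y i * y j))
        + (∑ i, ∑ j, da a u j l i * (y i * y j)) - ∑ i, ∑ j, da a u l i j * (y i * y j)) := by
    simp only [Finset.mul_sum, ← Finset.sum_add_distrib, ← Finset.sum_sub_distrib]
    exact Finset.sum_congr rfl fun i _ => Finset.sum_congr rfl fun j _ => by ring
  rw [h1]
  simp only [sum_mul_chr hdet]
  rw [h4, h2, h3]
  simp only [qf, lower, Matrix.of_apply, Finset.sum_mul]
  ring

/-- The derivative of `α²` along `y`, in terms of `chrSpray`. -/
theorem qf_da_contract (hdet : IsUnit (a u).det) (hs : (a u).IsSymm) :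
    ∑ k, qf (Matrix.of (da a u k)) y * y k
      = 2 * lf (lower (a u) y) (WithLp.toLp 2 (chrSpray a u y)) := by
  have h1 : lf (lower (a u) y) (WithLp.toLp 2 (chrSpray a u y))
      = ∑ l, lf (a u l) (WithLp.toLp 2 (chrSpray a u y)) * y l := by
    simp only [lf, lower, Finset.sum_mul]
    rw [Finset.sum_comm]
    exact Finset.sum_congr rfl fun i _ => Finset.sum_congr rfl fun j _ => by
      rw [hs.apply]; ring
  rw [h1]
  simp only [lower_chrSpray y hdet, sub_mul, Finset.sum_sub_distrib, Finset.sum_mul]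
  have h2 : ∑ l, ∑ k, lower (Matrix.of (da a u k)) y l * y k * y l
      = ∑ k, qf (Matrix.of (da a u k)) y * y k := by
    rw [Finset.sum_comm]
    refine Finset.sum_congr rfl fun k _ => ?_
    rw [qf_eq_lf_lower, lf, Finset.sum_mul]
    exact Finset.sum_congr rfl fun j _ => by ring
  rw [h2]
  have h3 : ∑ l, 1 / 2 * qf (Matrix.of (da a u l)) y * y l
      = 1 / 2 * ∑ k, qf (Matrix.of (da a u k)) y * y k := by
    rw [Finset.mul_sum]; exact Finset.sum_congr rfl fun j _ => by ring
  rw [h3]; ring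

variable (hb : ∀ i j, db b u j i - ∑ k, chr a u k i j * b u k = c * a u i j)
include hb

/-- A 1-form with `b_{i|j} = c a_{ij}` is closed. -/
theorem db_symm (hs : (a u).IsSymm) (hsymm : ∀ k i j, da a u k i j = da a u k j i)
    (i j : Fin n) : db b u i j = db b u j i := by
  have h1 := hb i j
  have h2 := hb j i
  simp only [chr_symm hsymm _ j i] at h2
  rw [hs.apply] at h2
  linarith

/-- The derivative of `β` along `y`: the covariant part contributes `c α²`. -/
theorem lf_db_contract :
    ∑ k, lf (db b u k) y * y k
      = lf (b u) (WithLp.toLp 2 (chrSpray a u y)) + c * qf (a u) y := by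
  have h : ∀ i j, db b u j i = ∑ k, chr a u k i j * b u k + c * a u i j := fun i j => by
    linarith [hb i j]
  simp only [lf, h, add_mul, Finset.sum_add_distrib]
  congr 1
  · simp only [chrSpray, qf, Finset.mul_sum, Finset.sum_mul, Matrix.of_apply]
    rw [Finset.sum_comm (s := (Finset.univ : Finset (Fin n)))]
    have e : ∀ i : Fin n, ∑ j, ∑ k, chr a u k i j * b u k * y i * y j
        = ∑ k, ∑ j, b u k * (chr a u k i j * (y i * y j)) := fun i => by
      rw [Finset.sum_comm]
      exact Finset.sum_congr rfl fun i _ => Finset.sum_congr rfl fun j _ => by ring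
    simp only [e]
    rw [Finset.sum_comm]
  · simp only [qf, Finset.mul_sum, Finset.sum_mul]
    rw [Finset.sum_comm]
    exact Finset.sum_congr rfl fun i _ => Finset.sum_congr rfl fun j _ => by ring

end contraction

end

/-! ### The spray of `F` from second derivatives of `F²` -/

section

variable {n : ℕ}

section spray
variable {a : Coord n → Matrix (Fin n) (Fin n) ℝ} {b : Coord n → Fin n → ℝ} {t : Coord n → ℝ}
  {u y : Coord n}

variable (a b t) in
/-- The arguments `(b², α², β)` of `lag φ` at the tangent vector with coordinates `(w, y)`. -/
def lagArg (w y : Coord n) : ℝ × ℝ × ℝ := (t w, qf (a w) y, lf (b w) y)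

theorem hasFDerivAt_lagArg_right (w y : Coord n) :
    HasFDerivAt (fun y => lagArg a b t w y)
      ((0 : Coord n →L[ℝ] ℝ).prod ((fderiv ℝ (qf (a w)) y).prod (fderiv ℝ (lf (b w)) y))) y :=
  (hasFDerivAt_const _ _).prodMk
    ((hasFDerivAt_qf _ _).differentiableAt.hasFDerivAt.prodMk
      (hasFDerivAt_lf _ _).differentiableAt.hasFDerivAt)

theorem fderiv_comp_lagArg_right {Ψ : ℝ × ℝ × ℝ → ℝ} {x1 x2 x3 : ℝ} {w : Coord n}
    (hs : (a w).IsSymm) (h : HasFDerivAt Ψ (grad3 x1 x2 x3) (lagArg a b t w y)) (l : Fin n) :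
    fderiv ℝ (fun y => Ψ (lagArg a b t w y)) y (EuclideanSpace.single l 1)
      = x2 * (2 * lower (a w) y l) + x3 * b w l := by
  have h' := h.comp (f := fun y => lagArg a b t w y) y (hasFDerivAt_lagArg_right w y)
  rw [Function.comp_def] at h'
  rw [h'.fderiv]
  simp [fderiv_qf_single hs, fderiv_lf_single]

section vertical
variable {φ : ℝ → ℝ → ℝ} {F : Coord n → Coord n → ℝ}
  (hF : ∀ y, 0 < qf (a u) y → F u y ^ 2 = lag φ (lagArg a b t u y)) (hs : (a u).IsSymm)
  (hpos : 0 < qf (a u) y)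
include hF hs hpos

theorem pdy_sq (hlag : ∃ r, HasFDerivAt (lag φ) (grad3 r (lagA φ (lagArg a b t u y))
      (lagB φ (lagArg a b t u y))) (lagArg a b t u y)) (l : Fin n) :
    pdy l (fun u y => F u y ^ 2) u y
      = lagA φ (lagArg a b t u y) * (2 * lower (a u) y l)
        + lagB φ (lagArg a b t u y) * b u l := by
  obtain ⟨r, hr⟩ := hlag
  rw [← fderiv_comp_lagArg_right hs hr l]
  unfold pdy
  congr 1
  refine Filter.EventuallyEq.fderiv_eq ?_
  filter_upwards [(hasFDerivAt_qf (a u) y).continuousAt.eventually (lt_mem_nhds hpos)] with x hx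
    using hF x hx

variable (hlag : ∀ᶠ p in nhds (lagArg a b t u y), ∃ r,
  HasFDerivAt (lag φ) (grad3 r (lagA φ p) (lagB φ p)) p)
include hlag

/-- The formula of `pdy_sq` holds near `y`, so it can be differentiated again. -/
theorem pdy_sq_eventuallyEq (l : Fin n) :
    pdy l (fun u y => F u y ^ 2) u =ᶠ[nhds y]
      fun y' => lagA φ (lagArg a b t u y') * (2 * lower (a u) y' l)
          + lagB φ (lagArg a b t u y') * b u l := by
  filter_upwards [(hasFDerivAt_qf (a u) y).continuousAt.eventually (lt_mem_nhds hpos),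
    (hasFDerivAt_lagArg_right u y).continuousAt.eventually hlag] with x hx hx'
  exact pdy_sq hF hs hx hx' l

/-- The Hessian of `F²` in the fibre directions. -/
theorem pdy_pdy_sq {LAt LAA LAB LBt LBB : ℝ}
    (hLA : HasFDerivAt (lagA φ) (grad3 LAt LAA LAB) (lagArg a b t u y))
    (hLB : HasFDerivAt (lagB φ) (grad3 LBt LAB LBB) (lagArg a b t u y)) (l m : Fin n) :
    pdy m (pdy l (fun u y => F u y ^ 2)) u y
      = (LAA * (2 * lower (a u) y m) + LAB * b u m) * (2 * lower (a u) y l)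
        + lagA φ (lagArg a b t u y) * (2 * a u l m)
        + (LAB * (2 * lower (a u) y m) + LBB * b u m) * b u l := by
  have e1 := fderiv_comp_lagArg_right hs hLA m
  have e2 := fderiv_comp_lagArg_right hs hLB m
  have d1 := (hLA.comp (f := fun y => lagArg a b t u y) y
    (hasFDerivAt_lagArg_right u y)).differentiableAt.hasFDerivAt
  have d2 := (hLB.comp (f := fun y => lagArg a b t u y) y
    (hasFDerivAt_lagArg_right u y)).differentiableAt.hasFDerivAt
  have d3 := hasFDerivAt_lf (a u l) y
  have e3 := fderiv_lf_single (a u l) y m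
  rw [d3.fderiv] at e3
  have := ((d1.mul (d3.const_mul 2)).add (d2.mul_const (b u l)))
  rw [pdy, (pdy_sq_eventuallyEq hF hs hpos hlag l).fderiv_eq]
  erw [this.fderiv]
  simp only [Function.comp_def, _root_.add_apply, _root_.smul_apply,
    smul_eq_mul, e1, e2, e3]
  have e4 : lf (a u l) y = lower (a u) y l := rfl
  rw [e4]
  ring

end vertical

variable (ha : ∀ i j, DifferentiableAt ℝ (fun w => a w i j) u)
  (hb : ∀ i, DifferentiableAt ℝ (fun w => b w i) u)

include ha in
theorem hasFDerivAt_qf_left (y : Coord n) : HasFDerivAt (fun w => qf (a w) y)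
    (∑ i, ∑ j, (y i * y j) • fderiv ℝ (fun w => a w i j) u) u :=
  HasFDerivAt.fun_sum fun i _ => HasFDerivAt.fun_sum fun j _ =>
    (ha i j).hasFDerivAt.mul_const (y i * y j)

include hb in
theorem hasFDerivAt_lf_left (y : Coord n) : HasFDerivAt (fun w => lf (b w) y)
    (∑ i, y i • fderiv ℝ (fun w => b w i) u) u :=
  HasFDerivAt.fun_sum fun i _ => (hb i).hasFDerivAt.mul_const (y i)

include ha in
theorem hasFDerivAt_lower_left (y : Coord n) (l : Fin n) :
    HasFDerivAt (fun w => lower (a w) y l)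
      (∑ j, y j • fderiv ℝ (fun w => a w l j) u) u :=
  HasFDerivAt.fun_sum fun j _ => (ha l j).hasFDerivAt.mul_const (y j)

include ha hb

theorem hasFDerivAt_lagArg_left (ht : DifferentiableAt ℝ t u) (y : Coord n) :
    HasFDerivAt (fun w => lagArg a b t w y)
      ((fderiv ℝ t u).prod ((∑ i, ∑ j, (y i * y j) • fderiv ℝ (fun w => a w i j) u).prod
        (∑ i, y i • fderiv ℝ (fun w => b w i) u))) u :=
  ht.hasFDerivAt.prodMk ((hasFDerivAt_qf_left ha y).prodMk (hasFDerivAt_lf_left hb y))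

theorem hasFDerivAt_comp_lagArg_left (ht : DifferentiableAt ℝ t u) {Ψ : ℝ × ℝ × ℝ → ℝ}
    {x1 x2 x3 : ℝ} (h : HasFDerivAt Ψ (grad3 x1 x2 x3) (lagArg a b t u y)) :
    ∃ D : Coord n →L[ℝ] ℝ, HasFDerivAt (fun w => Ψ (lagArg a b t w y)) D u ∧
      ∀ k, D (EuclideanSpace.single k 1)
        = x1 * fderiv ℝ t u (EuclideanSpace.single k 1) + x2 * qf (Matrix.of (da a u k)) y
          + x3 * lf (db b u k) y := by
  refine ⟨_, h.comp (f := fun w => lagArg a b t w y) u (hasFDerivAt_lagArg_left ha hb ht y),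
    fun k => ?_⟩
  have h1 : ∀ i j : Fin n, y i * y j * fderiv ℝ (fun w => a w i j) u (EuclideanSpace.single k 1)
      = fderiv ℝ (fun w => a w i j) u (EuclideanSpace.single k 1) * (y i * y j) :=
    fun i j => mul_comm _ _
  have h2 : ∀ i : Fin n, y i * fderiv ℝ (fun w => b w i) u (EuclideanSpace.single k 1)
      = fderiv ℝ (fun w => b w i) u (EuclideanSpace.single k 1) * y i := fun i => mul_comm _ _
  simp [qf, lf, da, db, h1, h2]

/-- The spray of `F = √(lag φ(b², α², β))` for a form with `b_{i|j} = c a_{ij}`: it differs from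
the Riemannian spray by `c (p y + q b)`, where `p` and `q` solve two linear equations whose
coefficients are second derivatives of `lag φ`. The hypotheses `hE1` and `hE2` are Euler's relations
for `lagA φ` and `lagB φ`, which are homogeneous of degrees `0` and `1` in `(√A, B)`. -/
theorem spray_eq_of_hasFDerivAt {φ : ℝ → ℝ → ℝ} {F : Coord n → Coord n → ℝ} {c : ℝ}
    {bs : Coord n}
    (hdet : IsUnit (a u).det) (hs : ∀ w, (a w).IsSymm) (ht : DifferentiableAt ℝ t u)
    (hF : ∀ᶠ w in nhds u, ∀ y, 0 < qf (a w) y → F w y ^ 2 = lag φ (lagArg a b t w y))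
    (hpos : 0 < qf (a u) y)
    (hlag : ∀ᶠ p in nhds (lagArg a b t u y), ∃ r,
      HasFDerivAt (lag φ) (grad3 r (lagA φ p) (lagB φ p)) p)
    {Lt LAt LAA LAB LBt LBB : ℝ}
    (hL : HasFDerivAt (lag φ) (grad3 Lt (lagA φ (lagArg a b t u y)) (lagB φ (lagArg a b t u y)))
      (lagArg a b t u y))
    (hLA : HasFDerivAt (lagA φ) (grad3 LAt LAA LAB) (lagArg a b t u y))
    (hLB : HasFDerivAt (lagB φ) (grad3 LBt LAB LBB) (lagArg a b t u y))
    (hE1 : 2 * qf (a u) y * LAA + lf (b u) y * LAB = 0)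
    (hE2 : 2 * qf (a u) y * LAB + lf (b u) y * LBB = lagB φ (lagArg a b t u y))
    (hcov : ∀ i j, db b u j i - ∑ k, chr a u k i j * b u k = c * a u i j)
    (hdt : ∀ k, fderiv ℝ t u (EuclideanSpace.single k 1) = 2 * c * b u k)
    (hbs : ∀ i, lower (a u) bs i = b u i) (htu : lf (b u) bs = t u)
    (hg : IsUnit (fundamentalTensor F u y).det) {p q : ℝ}
    (hp : 2 * p * lagA φ (lagArg a b t u y) + 2 * q * (2 * lf (b u) y * LAA + t u * LAB)
      = qf (a u) y * LAB + 2 * lf (b u) y * LAt)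
    (hq : 2 * (p * lagB φ (lagArg a b t u y)
        + q * (2 * lf (b u) y * LAB + 2 * lagA φ (lagArg a b t u y) + t u * LBB))
      = qf (a u) y * LBB + 2 * lf (b u) y * LBt - 2 * Lt) (i : Fin n) :
    spray F i u y = (1 / 2) * chrSpray a u y i + c * (p * y i + q * bs i) := by
  have hsymm : ∀ k i j, da a u k i j = da a u k j i := fun k i j => by
    simp only [da]; congr 2; funext w; exact (hs w).apply j i
  -- the formula for `[F²]_{yˡ}` at the points near `u`
  have hyw : ∀ l, (fun w => pdy l (fun u y => F u y ^ 2) w y) =ᶠ[nhds u]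
      fun w => lagA φ (lagArg a b t w y) * (2 * lower (a w) y l)
          + lagB φ (lagArg a b t w y) * b w l := fun l => by
    filter_upwards [hF, (hasFDerivAt_qf_left ha y).continuousAt.eventually (lt_mem_nhds hpos),
      (hasFDerivAt_lagArg_left ha hb ht y).continuousAt.eventually hlag] with w hw hx hx'
    exact pdy_sq hw (hs w) hx hx' l
  have hess := fun l m => pdy_pdy_sq hF.self_of_nhds (hs u) hpos hlag hLA hLB l m
  -- the mixed derivatives of `F²`
  have mixed : ∀ l k, pdx k (pdy l (fun u y => F u y ^ 2)) u y
      = (LAt * (2 * c * b u k) + LAA * qf (Matrix.of (da a u k)) y + LAB * lf (db b u k) y)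
          * (2 * lower (a u) y l)
        + lagA φ (lagArg a b t u y) * (2 * lower (Matrix.of (da a u k)) y l)
        + (LBt * (2 * c * b u k) + LAB * qf (Matrix.of (da a u k)) y + LBB * lf (db b u k) y)
          * b u l
        + lagB φ (lagArg a b t u y) * db b u k l := by
    intro l k
    obtain ⟨DA, d1, e1⟩ := hasFDerivAt_comp_lagArg_left ha hb ht hLA
    obtain ⟨DB, d2, e2⟩ := hasFDerivAt_comp_lagArg_left ha hb ht hLB
    have d3 := hasFDerivAt_lower_left ha y l
    have d4 := (hb l).hasFDerivAt
    have := ((d1.mul (d3.const_mul 2)).add (d2.mul d4))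
    rw [pdx, (hyw l).fderiv_eq]
    erw [this.fderiv]
    have e3 : (∑ j, y j • fderiv ℝ (fun w => a w l j) u) (EuclideanSpace.single k 1)
        = lower (Matrix.of (da a u k)) y l := by
      simp [lower, da, mul_comm]
    have e4 : fderiv ℝ (fun w => b w l) u (EuclideanSpace.single k 1) = db b u k l := rfl
    simp only [_root_.add_apply, _root_.smul_apply,
      smul_eq_mul, e1, e2, e3, e4, hdt]
    ring
  have dx : ∀ l, pdx l (fun u y => F u y ^ 2) u y
      = Lt * (2 * c * b u l) + lagA φ (lagArg a b t u y) * qf (Matrix.of (da a u l)) y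
        + lagB φ (lagArg a b t u y) * lf (db b u l) y := by
    intro l
    obtain ⟨D, d1, e1⟩ := hasFDerivAt_comp_lagArg_left ha hb ht hL
    rw [← hdt, ← e1, ← d1.fderiv, pdx]
    congr 1
    refine Filter.EventuallyEq.fderiv_eq ?_
    filter_upwards [hF, (hasFDerivAt_qf_left ha y).continuousAt.eventually
      (lt_mem_nhds hpos)] with w hw hx using hw y hx
  set G0 : Coord n := WithLp.toLp 2 (chrSpray a u y) with hG0
  set G : Coord n := WithLp.toLp 2
    (fun i => (1 / 2) * chrSpray a u y i + c * (p * y i + q * bs i)) with hG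
  have hGv : G = (1 / 2 : ℝ) • G0 + (c * p) • y + (c * q) • bs := by
    ext i; simp [hG, hG0]; ring
  -- `g_{lm} G^m` is a quarter of the Euler-Lagrange expression
  have key : ∀ l, (1 / 4) * ((∑ k, pdx k (pdy l (fun u y => F u y ^ 2)) u y * y k)
      - pdx l (fun u y => F u y ^ 2) u y) = ((fundamentalTensor F u y).mulVec G.ofLp) l := by
    intro l
    have c1 := qf_da_contract y hdet (hs u)
    have c2 := lf_db_contract y hcov
    have c3 := lower_chrSpray y hdet l
    have c4 : ∑ k, db b u k l * y k = lf (db b u l) y :=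
      Finset.sum_congr rfl fun k _ => by rw [db_symm hcov (hs u) hsymm]
    have s1 : ∑ k, pdx k (pdy l (fun u y => F u y ^ 2)) u y * y k
        = (LAt * (2 * c * lf (b u) y) + LAA * (∑ k, qf (Matrix.of (da a u k)) y * y k)
            + LAB * ∑ k, lf (db b u k) y * y k) * (2 * lower (a u) y l)
          + lagA φ (lagArg a b t u y) * (2 * ∑ k, lower (Matrix.of (da a u k)) y l * y k)
          + (LBt * (2 * c * lf (b u) y) + LAB * (∑ k, qf (Matrix.of (da a u k)) y * y k)
            + LBB * ∑ k, lf (db b u k) y * y k) * b u l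
          + lagB φ (lagArg a b t u y) * ∑ k, db b u k l * y k := by
      simp only [mixed, lf, Finset.mul_sum, Finset.sum_mul, ← Finset.sum_add_distrib]
      refine Finset.sum_congr rfl fun k _ => ?_
      simp only [← Finset.mul_sum, ← Finset.sum_mul]
      ring
    have s2 : ∀ v : Coord n, ∑ m, pdy m (pdy l (fun u y => F u y ^ 2)) u y * v m
        = (LAA * (2 * lf (lower (a u) y) v) + LAB * lf (b u) v) * (2 * lower (a u) y l)
          + lagA φ (lagArg a b t u y) * (2 * lower (a u) v l)
          + (LAB * (2 * lf (lower (a u) y) v) + LBB * lf (b u) v) * b u l := by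
      intro v
      have e4 : lower (a u) v l = lf (a u l) v := rfl
      rw [e4]
      simp only [hess, lf, Finset.mul_sum, Finset.sum_mul, ← Finset.sum_add_distrib]
      refine Finset.sum_congr rfl fun k _ => ?_
      ring
    have s3 : ((fundamentalTensor F u y).mulVec G.ofLp) l
        = (1 / 2) * ((1 / 2) * ∑ m, pdy m (pdy l (fun u y => F u y ^ 2)) u y * G0 m
          + c * p * ∑ m, pdy m (pdy l (fun u y => F u y ^ 2)) u y * y m
          + c * q * ∑ m, pdy m (pdy l (fun u y => F u y ^ 2)) u y * bs m) := by
      rw [hGv]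
      simp only [Matrix.mulVec, dotProduct, fundamentalTensor, Matrix.of_apply, Finset.mul_sum,
        ← Finset.sum_add_distrib, PiLp.add_apply, PiLp.smul_apply, smul_eq_mul]
      refine Finset.sum_congr rfl fun k _ => ?_
      ring
    have r1 : lf (lower (a u) y) y = qf (a u) y := (qf_eq_lf_lower _ _).symm
    have r2 : lf (lower (a u) y) bs = lf (b u) y := by
      have : lf (lower (a u) y) bs = lf (lower (a u) bs) y := by
        simp only [lf, lower, Finset.sum_mul]
        rw [Finset.sum_comm]
        exact Finset.sum_congr rfl fun i _ => Finset.sum_congr rfl fun j _ => by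
          rw [(hs u).apply]; ring
      rw [this]
      exact Finset.sum_congr rfl fun i _ => by rw [hbs]
    have r3 : lower (a u) G0 l = lf (a u l) G0 := rfl
    rw [s3, s2, s2, s2, s1, dx, c1, c2, c4, r1, r2, r3, hbs, htu, c3]
    -- the parts along `lower y` and along `b` vanish by `hp` and `hq`; `hE1` and `hE2` reduce
    -- `g_{lm} yᵐ`
    linear_combination (-(c * lower (a u) y l) / 2) * hp - (c * b u l / 4) * hq
      - (c * p * lower (a u) y l) * hE1 - (c * p * b u l / 2) * hE2
  have fin : spray F i u y = ((fundamentalTensor F u y)⁻¹.mulVec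
      ((fundamentalTensor F u y).mulVec G.ofLp)) i := by
    rw [spray, Finset.mul_sum, Matrix.mulVec, dotProduct]
    refine Finset.sum_congr rfl fun l _ => ?_
    rw [← key l]; ring
  rw [fin, Matrix.mulVec_mulVec, Matrix.nonsing_inv_mul _ hg]
  simp [hG]

end spray

end

/-! ### The derivative of `b²` -/

section

variable {n : ℕ}

theorem differentiableAt_det {m : ℕ} {a : Coord n → Matrix (Fin m) (Fin m) ℝ} {u : Coord n}
    (ha : ∀ i j, DifferentiableAt ℝ (fun w => a w i j) u) :
    DifferentiableAt ℝ (fun w => (a w).det) u := by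
  simp only [Matrix.det_apply']
  exact DifferentiableAt.fun_sum fun σ _ => DifferentiableAt.const_mul
    (HasFDerivAt.finsetProd (u := Finset.univ) (g := fun i w => a w (σ i) i)
      fun i _ => (ha (σ i) i).hasFDerivAt).differentiableAt _

/-- The vector `b^i = a^{ij} b_j`. -/
def raise (M : Matrix (Fin n) (Fin n) ℝ) (b : Fin n → ℝ) : Coord n :=
  WithLp.toLp 2 (M⁻¹.mulVec b)

theorem lower_raise {M : Matrix (Fin n) (Fin n) ℝ} (hM : IsUnit M.det) (b : Fin n → ℝ)
    (i : Fin n) : lower M (raise M b) i = b i := by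
  have : lower M (raise M b) i = M.mulVec (M⁻¹.mulVec b) i := rfl
  rw [this, Matrix.mulVec_mulVec, Matrix.mul_nonsing_inv _ hM, Matrix.one_mulVec]

section
variable {a : Coord n → Matrix (Fin n) (Fin n) ℝ} {b : Coord n → Fin n → ℝ} {u : Coord n}
  {c : ℝ} (ha : ∀ i j, DifferentiableAt ℝ (fun w => a w i j) u)
  (hb : ∀ i, DifferentiableAt ℝ (fun w => b w i) u) (hdet : IsUnit (a u).det)
include ha hb hdet

theorem differentiableAt_raise (i : Fin n) :
    DifferentiableAt ℝ (fun w => raise (a w) (b w) i) u := by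
  -- by Cramer's rule, `bⁱ` is a quotient of determinants
  have hd := differentiableAt_det ha
  have hne : (a u).det ≠ 0 := hdet.ne_zero
  have h2 : DifferentiableAt ℝ (fun w => ((a w).updateCol i (b w)).det) u :=
    differentiableAt_det fun p q => by
      by_cases h : q = i
      · subst h; simpa using hb p
      · simpa [Matrix.updateCol_ne h] using ha p q
  refine (h2.mul ((differentiableAt_inv hne).comp u hd)).congr_of_eventuallyEq ?_
  filter_upwards [hd.continuousAt.eventually_ne hne] with w hw
  have h3 := congrFun (Matrix.det_smul_inv_mulVec_eq_cramer (a w) (b w) (IsUnit.mk0 _ hw)) i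
  rw [Matrix.cramer_apply] at h3
  simp only [Pi.mul_apply, Function.comp_apply]
  rw [← h3]
  simp [raise]
  field_simp

theorem differentiableAt_normSq :
    DifferentiableAt ℝ (fun w => lf (b w) (raise (a w) (b w))) u :=
  DifferentiableAt.fun_sum fun i _ => (hb i).mul (differentiableAt_raise ha hb hdet i)

/-- If `b_{i|j} = c a_{ij}`, then `∂_k ‖β‖² = 2 c b_k`. -/
theorem fderiv_normSq (hs : ∀ w, (a w).IsSymm)
    (hcov : ∀ i j, db b u j i - ∑ k, chr a u k i j * b u k = c * a u i j) (k : Fin n) :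
    fderiv ℝ (fun w => lf (b w) (raise (a w) (b w))) u (EuclideanSpace.single k 1)
      = 2 * c * b u k := by
  set bs := fun w => raise (a w) (b w) with hbs
  have hsymm : ∀ k i j, da a u k i j = da a u k j i := fun k i j => by
    simp only [da]; congr 2; funext w; exact (hs w).apply j i
  have hlow : ∀ i, ∑ j, a u i j * bs u j = b u i := fun i => lower_raise hdet (b u) i
  let dbs := fun i => fderiv ℝ (fun w => bs w i) u (EuclideanSpace.single k 1)
  have h1 : fderiv ℝ (fun w => lf (b w) (bs w)) u (EuclideanSpace.single k 1)
      = ∑ i, (b u i * dbs i + bs u i * db b u k i) := by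
    have : HasFDerivAt (fun w => lf (b w) (bs w)) _ u := HasFDerivAt.fun_sum fun i _ =>
      (hb i).hasFDerivAt.mul (differentiableAt_raise ha hb hdet i).hasFDerivAt
    rw [this.fderiv]
    simp [db, dbs, hbs]
  have h2 : ∀ i, db b u k i = ∑ j, (a u i j * dbs j + bs u j * da a u k i j) := by
    intro i
    have e : (fun w => b w i) =ᶠ[nhds u] fun w => ∑ j, a w i j * bs w j := by
      filter_upwards [(differentiableAt_det ha).continuousAt.eventually_ne hdet.ne_zero] with w hw
      exact (lower_raise (IsUnit.mk0 _ hw) (b w) i).symm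
    have : HasFDerivAt (fun w => ∑ j, a w i j * bs w j) _ u := HasFDerivAt.fun_sum fun j _ =>
      (ha i j).hasFDerivAt.mul (differentiableAt_raise ha hb hdet j).hasFDerivAt
    rw [db, e.fderiv_eq, this.fderiv]
    simp [da, dbs, hbs]
  have h3 : ∑ i, bs u i * db b u k i
      = (∑ j, b u j * dbs j) + qf (Matrix.of (da a u k)) (bs u) := by
    simp only [h2, Finset.sum_add_distrib, mul_add, Finset.mul_sum]
    congr 1
    · rw [Finset.sum_comm]
      refine Finset.sum_congr rfl fun j _ => ?_
      rw [← hlow j, Finset.sum_mul]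
      exact Finset.sum_congr rfl fun i _ => by rw [(hs u).apply]; ring
    · exact Finset.sum_congr rfl fun i _ => Finset.sum_congr rfl fun j _ => by
        simp only [Matrix.of_apply]; ring
  have h4 : ∀ i, ∑ m, chr a u m i k * b u m
      = ∑ l, bs u l * ((1 / 2) * (da a u i l k + da a u k l i - da a u l i k)) := by
    intro i
    simp only [← sum_mul_chr hdet, Finset.mul_sum]
    rw [Finset.sum_comm]
    refine Finset.sum_congr rfl fun m _ => ?_
    rw [← hlow m, Finset.mul_sum]
    exact Finset.sum_congr rfl fun l _ => by rw [(hs u).apply l m]; ring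
  have h5 : ∑ i, bs u i * db b u k i
      = (1 / 2) * qf (Matrix.of (da a u k)) (bs u) + c * b u k := by
    have e : ∀ i, bs u i * db b u k i
        = (∑ l, ((1 / 2) * (da a u i l k * (bs u i * bs u l))
            + (1 / 2) * (da a u k i l * (bs u i * bs u l))
            - (1 / 2) * (da a u l i k * (bs u i * bs u l)))) + c * (a u k i * bs u i) := by
      intro i
      have : db b u k i = ∑ m, chr a u m i k * b u m + c * a u i k := by linarith [hcov i k]
      rw [this, h4, mul_add, Finset.mul_sum, (hs u).apply k i]
      congr 1
      · exact Finset.sum_congr rfl fun l _ => by rw [hsymm k l i]; ring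
      · ring
    simp only [e, Finset.sum_add_distrib, Finset.sum_sub_distrib, ← Finset.mul_sum, hlow]
    have e2 : ∑ i, ∑ l, da a u i l k * (bs u i * bs u l)
        = ∑ i, ∑ l, da a u l i k * (bs u i * bs u l) := by
      rw [Finset.sum_comm]
      exact Finset.sum_congr rfl fun i _ => Finset.sum_congr rfl fun l _ => by ring
    rw [e2]
    simp only [qf, Matrix.of_apply]
    ring
  rw [h1, Finset.sum_add_distrib]
  linarith

end

end

/-! ### The spray coefficients in terms of `E` and `H` -/

section

variable {n : ℕ}

/-- The polar form `∑ M_{ij} xⁱ yʲ`. -/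
def bf (M : Matrix (Fin n) (Fin n) ℝ) (x y : Coord n) : ℝ := lf (lower M x) y

theorem lf_add (b : Fin n → ℝ) (x y : Coord n) : lf b (x + y) = lf b x + lf b y := by
  simp [lf, mul_add, Finset.sum_add_distrib]

theorem lf_smul (b : Fin n → ℝ) (r : ℝ) (x : Coord n) : lf b (r • x) = r * lf b x := by
  simp only [lf, Finset.mul_sum, PiLp.smul_apply, smul_eq_mul]
  exact Finset.sum_congr rfl fun i _ => by ring

theorem bf_self (M : Matrix (Fin n) (Fin n) ℝ) (y : Coord n) : bf M y y = qf M y :=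
  (qf_eq_lf_lower M y).symm

theorem bf_comm {M : Matrix (Fin n) (Fin n) ℝ} (hM : M.IsSymm) (x y : Coord n) :
    bf M x y = bf M y x := by
  simp only [bf, lf, lower, Finset.sum_mul]
  rw [Finset.sum_comm]
  exact Finset.sum_congr rfl fun i _ => Finset.sum_congr rfl fun j _ => by
    rw [hM.apply]; ring

theorem bf_add_right (M : Matrix (Fin n) (Fin n) ℝ) (x y z : Coord n) :
    bf M x (y + z) = bf M x y + bf M x z := lf_add _ _ _

theorem bf_smul_right (M : Matrix (Fin n) (Fin n) ℝ) (x y : Coord n) (r : ℝ) :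
    bf M x (r • y) = r * bf M x y := lf_smul _ _ _

theorem bf_add_left {M : Matrix (Fin n) (Fin n) ℝ} (hM : M.IsSymm) (x y z : Coord n) :
    bf M (x + y) z = bf M x z + bf M y z := by
  rw [bf_comm hM, bf_add_right, bf_comm hM z, bf_comm hM z]

theorem bf_smul_left {M : Matrix (Fin n) (Fin n) ℝ} (hM : M.IsSymm) (x y : Coord n) (r : ℝ) :
    bf M (r • x) y = r * bf M x y := by
  rw [bf_comm hM, bf_smul_right, bf_comm hM]

theorem qf_add {M : Matrix (Fin n) (Fin n) ℝ} (hM : M.IsSymm) (x y : Coord n) :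
    qf M (x + y) = qf M x + 2 * bf M x y + qf M y := by
  simp only [← bf_self, bf_add_left hM, bf_add_right, bf_comm hM y x]; ring

theorem qf_smul (M : Matrix (Fin n) (Fin n) ℝ) (r : ℝ) (x : Coord n) :
    qf M (r • x) = r ^ 2 * qf M x := by
  simp only [qf, Finset.mul_sum, PiLp.smul_apply, smul_eq_mul]
  exact Finset.sum_congr rfl fun i _ => Finset.sum_congr rfl fun j _ => by ring

theorem qf_eq_dotProduct (M : Matrix (Fin n) (Fin n) ℝ) (y : Coord n) :
    qf M y = y.ofLp ⬝ᵥ M.mulVec y.ofLp := by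
  simp only [qf, dotProduct, Matrix.mulVec, Finset.mul_sum]
  exact Finset.sum_congr rfl fun i _ => Finset.sum_congr rfl fun j _ => by ring

theorem qf_pos {M : Matrix (Fin n) (Fin n) ℝ} (hM : M.PosDef) {y : Coord n} (hy : y ≠ 0) :
    0 < qf M y := by
  rw [qf_eq_dotProduct]
  have : y.ofLp ≠ 0 := fun h => hy (by ext i; simp [h])
  simpa using hM.dotProduct_mulVec_pos this

theorem qf_nonneg {M : Matrix (Fin n) (Fin n) ℝ} (hM : M.PosDef) (y : Coord n) :
    0 ≤ qf M y := by
  rcases eq_or_ne y 0 with h | h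
  · simp [h, qf]
  · exact (qf_pos hM h).le

theorem isSymm_of_posDef {M : Matrix (Fin n) (Fin n) ℝ} (hM : M.PosDef) : M.IsSymm := by
  have := hM.isHermitian
  simpa [Matrix.IsHermitian, Matrix.IsSymm] using this

section
variable {M : Matrix (Fin n) (Fin n) ℝ} (hM : M.PosDef) {b : Fin n → ℝ} {bs : Coord n}
  (hbs : ∀ i, lower M bs i = b i) (y : Coord n)
include hbs

theorem bf_dual_left : bf M bs y = lf b y := by
  rw [bf, show lower M bs = b from funext hbs]

include hM
/-- The squared length of the component of the dual vector `bs` orthogonal to `y`. -/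
theorem qf_orth (hy : y ≠ 0) : qf M (bs + (-(lf b y / qf M y)) • y)
    = lf b bs - lf b y ^ 2 / qf M y := by
  have h := (qf_pos hM hy).ne'
  have hs := isSymm_of_posDef hM
  rw [qf_add hs, bf_smul_right, qf_smul, bf_dual_left hbs, ← bf_self M bs, bf_dual_left hbs]
  field_simp; ring

/-- The Cauchy-Schwarz inequality `β² ≤ b² α²`. -/
theorem sq_lf_le : lf b y ^ 2 ≤ lf b bs * qf M y := by
  rcases eq_or_ne y 0 with h | h
  · simp [h, lf, qf]
  have h1 := qf_pos hM h
  have h2 := qf_nonneg hM (bs + (-(lf b y / qf M y)) • y)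
  rw [qf_orth hM hbs y h, sub_nonneg, div_le_iff₀ h1] at h2
  exact h2

omit hbs in
/-- There is a unit vector orthogonal to `m < n` given covectors. -/
theorem exists_unit_orth {m : ℕ} (hm : m < n) (l : Fin m → Fin n → ℝ) :
    ∃ v : Coord n, qf M v = 1 ∧ ∀ i, lf (l i) v = 0 := by
  let T : Coord n →ₗ[ℝ] (Fin m → ℝ) :=
    { toFun := fun v i => lf (l i) v
      map_add' := fun x y => by funext i; exact lf_add _ _ _
      map_smul' := fun r x => by funext i; exact lf_smul _ _ _ }
  have hk : T.ker ≠ ⊥ := LinearMap.ker_ne_bot_of_finrank_lt (by simpa using hm)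
  obtain ⟨v, hv, hv0⟩ := Submodule.exists_mem_ne_zero_of_ne_bot hk
  have hp := qf_pos hM hv0
  refine ⟨(√(qf M v))⁻¹ • v, ?_, fun i => ?_⟩
  · rw [qf_smul, inv_pow, Real.sq_sqrt hp.le, inv_mul_cancel₀ hp.ne']
  · rw [lf_smul, show lf (l i) v = 0 from congrFun hv i, mul_zero]

end

section
variable {a : Coord n → Matrix (Fin n) (Fin n) ℝ} {b : Coord n → Fin n → ℝ} {t : Coord n → ℝ}
  {u y bs : Coord n} {φ : ℝ → ℝ → ℝ} {U : Set (ℝ × ℝ)} {F : Coord n → Coord n → ℝ}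

/-- The value of the fundamental tensor on a vector. -/
theorem qf_fundamentalTensor (hs : (a u).IsSymm)
    (hF : ∀ y, 0 < qf (a u) y → F u y ^ 2 = lag φ (lagArg a b t u y))
    (hpos : 0 < qf (a u) y)
    (hlag : ∀ᶠ p in nhds (lagArg a b t u y), ∃ r,
      HasFDerivAt (lag φ) (grad3 r (lagA φ p) (lagB φ p)) p)
    {LAt LAA LAB LBt LBB : ℝ}
    (hLA : HasFDerivAt (lagA φ) (grad3 LAt LAA LAB) (lagArg a b t u y))
    (hLB : HasFDerivAt (lagB φ) (grad3 LBt LAB LBB) (lagArg a b t u y)) (v : Coord n) :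
    qf (fundamentalTensor F u y) v = 2 * LAA * bf (a u) y v ^ 2
      + 2 * LAB * bf (a u) y v * lf (b u) v + (1 / 2) * LBB * lf (b u) v ^ 2
      + lagA φ (lagArg a b t u y) * qf (a u) v := by
  have e : ∀ i j, fundamentalTensor F u y i j * (v i * v j)
      = 2 * LAA * ((lower (a u) y i * v i) * (lower (a u) y j * v j))
        + LAB * ((lower (a u) y i * v i) * (b u j * v j))
        + LAB * ((b u i * v i) * (lower (a u) y j * v j))
        + (1 / 2) * LBB * ((b u i * v i) * (b u j * v j))
        + lagA φ (lagArg a b t u y) * (a u i j * (v i * v j)) := by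
    intro i j
    simp only [fundamentalTensor, Matrix.of_apply]
    rw [pdy_pdy_sq hF hs hpos hlag hLA hLB]
    ring
  have e2 : ∀ (r : ℝ) (f g : Fin n → ℝ),
      ∑ i, ∑ j, r * ((f i * v i) * (g j * v j)) = r * (lf f v * lf g v) := by
    intro r f g
    simp only [lf]
    rw [Finset.sum_mul_sum]
    simp only [Finset.mul_sum]
  have e3 : ∀ r : ℝ, ∑ i, ∑ j, r * (a u i j * (v i * v j)) = r * qf (a u) v := by
    intro r
    simp only [qf, Finset.mul_sum]
  refine (Finset.sum_congr rfl fun i _ => Finset.sum_congr rfl fun j _ => e i j).trans ?_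
  simp only [Finset.sum_add_distrib, e2, e3, bf]
  ring

variable (hU : IsOpen U) (hφ : ContDiffOn ℝ ∞ (Function.uncurry φ) U)

include hU hφ in
theorem eventually_hasFDerivAt_lag {p : ℝ × ℝ × ℝ} (hp : 0 < p.2.1)
    (hpU : (p.1, p.2.2 / √p.2.1) ∈ U) : ∀ᶠ p in nhds p, ∃ r,
      HasFDerivAt (lag φ) (grad3 r (lagA φ p) (lagB φ p)) p := by
  have h1 : ContinuousAt (fun p : ℝ × ℝ × ℝ => (p.1, p.2.2 / √p.2.1)) p :=
    ((hasFDerivAt_first p).prodMk (hasFDerivAt_ratio hp)).continuousAt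
  filter_upwards [(hasFDerivAt_second p).continuousAt.eventually (lt_mem_nhds hp),
    h1.eventually (hU.mem_nhds hpU)] with q h2 h3
  exact ⟨_, hasFDerivAt_lag hU hφ h2 h3 rfl rfl rfl rfl rfl rfl⟩

variable (hn : 2 ≤ n) (ha : (a u).PosDef) (hbs : ∀ i, lower (a u) bs i = b u i)
  (htu : lf (b u) bs = t u) (hy : y ≠ 0) (hyU : (t u, lf (b u) y / √(qf (a u) y)) ∈ U)
  (hF : ∀ y, 0 < qf (a u) y → F u y ^ 2 = lag φ (lagArg a b t u y))
  (hg : (fundamentalTensor F u y).PosDef) {s : ℝ} (hs : s = lf (b u) y / √(qf (a u) y))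
  (hφ0 : 0 < φ (t u) s)
include hU hφ hn ha hbs htu hy hyU hF hg hs hφ0

/-- Positive definiteness of the fundamental tensor makes the denominator of `Hfun` positive. -/
theorem denom_pos : 0 < φ (t u) s - s * D2 φ (t u) s + (t u - s ^ 2) * D2 (D2 φ) (t u) s := by
  have hsym := isSymm_of_posDef ha
  have hA := qf_pos ha hy
  have hp : 0 < (lagArg a b t u y).2.1 := hA
  have hlag := eventually_hasFDerivAt_lag hU hφ hp hyU
  have hα : 0 < √(qf (a u) y) := Real.sqrt_pos.2 hA
  have hLA := hasFDerivAt_lagA hU hφ hp hyU (t := t u) (α := √(qf (a u) y)) (s := s)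
    rfl rfl hs rfl rfl rfl rfl rfl
  have hLB := hasFDerivAt_lagB hU hφ hp hyU (t := t u) (α := √(qf (a u) y)) (s := s)
    rfl rfl hs rfl rfl rfl rfl rfl
  have hval : lagA φ (lagArg a b t u y) = φ (t u) s ^ 2 - s * (φ (t u) s * D2 φ (t u) s) := by
    rw [hs]; rfl
  have G := fun v => qf_fundamentalTensor hsym hF hA hlag hLA hLB v
  rw [hval] at G
  generalize D2 (D2 φ) (t u) s = f22 at *
  generalize D2 (D1 φ) (t u) s = f12 at *
  generalize D1 φ (t u) s = f1 at *
  generalize D2 φ (t u) s = f2 at *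
  generalize φ (t u) s = f at *
  have hsq : √(qf (a u) y) ^ 2 = qf (a u) y := Real.sq_sqrt hA.le
  generalize √(qf (a u) y) = α at *
  have hB : lf (b u) y = s * α := by rw [hs]; field_simp
  have hw : 0 ≤ t u - s ^ 2 := by
    have := sq_lf_le ha hbs y
    rw [hB, htu, ← hsq] at this
    have h2 : s ^ 2 * α ^ 2 ≤ t u * α ^ 2 := by linarith
    nlinarith [le_of_mul_le_mul_right h2 (by positivity)]
  rcases hw.eq_or_lt with hw | hw
  · -- `b` is parallel to `y`; the fundamental tensor is evaluated on a unit vector orthogonal to `y`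
    obtain ⟨v, hv1, hv2⟩ := exists_unit_orth ha (m := 1) (by omega) (fun _ => lower (a u) y)
    have hv3 : bf (a u) y v = 0 := hv2 0
    have hz : bs + (-(lf (b u) y / qf (a u) y)) • y = 0 := by
      by_contra hne
      have := qf_pos ha hne
      rw [qf_orth ha hbs y hy, hB, htu, ← hsq] at this
      have e : t u - (s * α) ^ 2 / α ^ 2 = t u - s ^ 2 := by field_simp
      rw [e] at this; linarith
    have hv4 : lf (b u) v = 0 := by
      have h0 : bs = (lf (b u) y / qf (a u) y) • y := by
        rw [neg_smul] at hz; exact add_neg_eq_zero.1 hz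
      rw [← bf_dual_left hbs, h0, bf_smul_left hsym, hv3, mul_zero]
    have hv0 : v ≠ 0 := by rintro rfl; simp [qf] at hv1
    have := qf_pos hg hv0
    rw [G, hv3, hv4, hv1] at this
    rw [← hw]
    have h3 : 0 < f * (f - s * f2) := by nlinarith
    have := pos_of_mul_pos_right h3 hφ0.le
    linarith
  · -- the vector `dF(b) y - F b`, which is `g`-orthogonal to `y`
    set v : Coord n := (s * f + (t u - s ^ 2) * f2) • y + (-(α * f)) • bs with hv
    have hb1 : bf (a u) y bs = s * α := by rw [bf_comm hsym, bf_dual_left hbs, hB]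
    have h1 : bf (a u) y v = (s * f + (t u - s ^ 2) * f2) * α ^ 2 - α * f * (s * α) := by
      rw [hv, bf_add_right, bf_smul_right, bf_smul_right, bf_self, hb1, ← hsq]; ring
    have h2 : lf (b u) v = (s * f + (t u - s ^ 2) * f2) * (s * α) - α * f * t u := by
      rw [hv, lf_add, lf_smul, lf_smul, hB, htu]; ring
    have h3 : qf (a u) v = (s * f + (t u - s ^ 2) * f2) ^ 2 * α ^ 2
        - 2 * (s * f + (t u - s ^ 2) * f2) * (α * f) * (s * α) + (α * f) ^ 2 * t u := by
      rw [hv, qf_add hsym, qf_smul, qf_smul, bf_smul_left hsym, bf_smul_right, hb1, ← hsq,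
        ← bf_self _ bs, bf_dual_left hbs, htu]; ring
    have hv0 : v ≠ 0 := by
      intro h0
      have e1 : bf (a u) y v = 0 := by rw [h0]; simp [bf, lf]
      have e2 : lf (b u) v = 0 := by rw [h0]; simp [lf]
      rw [h1] at e1; rw [h2] at e2
      have : α * f * (t u - s ^ 2) = 0 := by
        have : α * (α * f * (t u - s ^ 2))
            = s * ((s * f + (t u - s ^ 2) * f2) * α ^ 2 - α * f * (s * α))
              - α * ((s * f + (t u - s ^ 2) * f2) * (s * α) - α * f * t u) := by ring
        rw [e1, e2] at this
        simpa [hα.ne'] using this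
      have : 0 < α * f * (t u - s ^ 2) := by positivity
      linarith
    have := qf_pos hg hv0
    rw [G, h1, h2, h3] at this
    have e : 2 * (-s / (2 * α ^ 2) * (f * f2 - s * (f2 ^ 2 + f * f22)))
          * ((s * f + (t u - s ^ 2) * f2) * α ^ 2 - α * f * (s * α)) ^ 2
        + 2 * ((f * f2 - s * (f2 ^ 2 + f * f22)) / α)
          * ((s * f + (t u - s ^ 2) * f2) * α ^ 2 - α * f * (s * α))
          * ((s * f + (t u - s ^ 2) * f2) * (s * α) - α * f * t u)
        + (1 / 2) * (2 * (f2 ^ 2 + f * f22))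
          * ((s * f + (t u - s ^ 2) * f2) * (s * α) - α * f * t u) ^ 2
        + (f ^ 2 - s * (f * f2)) * ((s * f + (t u - s ^ 2) * f2) ^ 2 * α ^ 2
          - 2 * (s * f + (t u - s ^ 2) * f2) * (α * f) * (s * α) + (α * f) ^ 2 * t u)
        = α ^ 2 * f ^ 3 * (t u - s ^ 2) * (f - s * f2 + (t u - s ^ 2) * f22) := by
      field_simp
      ring
    rw [e] at this
    exact pos_of_mul_pos_right this (by positivity)

/-- The spray of `F = α φ(b², s)` for a 1-form with `b_{i|j} = c a_{ij}`:
`Gⁱ = Gⁱ_α + c α E yⁱ + c α² H bⁱ`. -/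
theorem spray_eq (haD : ∀ i j, DifferentiableAt ℝ (fun w => a w i j) u)
    (hbD : ∀ i, DifferentiableAt ℝ (fun w => b w i) u) (has : ∀ w, (a w).IsSymm)
    (ht : DifferentiableAt ℝ t u) {c : ℝ}
    (hFw : ∀ᶠ w in nhds u, ∀ y, 0 < qf (a w) y → F w y ^ 2 = lag φ (lagArg a b t w y))
    (hcov : ∀ i j, db b u j i - ∑ k, chr a u k i j * b u k = c * a u i j)
    (hdt : ∀ k, fderiv ℝ t u (EuclideanSpace.single k 1) = 2 * c * b u k) (i : Fin n) :
    spray F i u y = (1 / 2) * chrSpray a u y i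
      + c * (√(qf (a u) y) * Efun φ (t u) s * y i + qf (a u) y * Hfun φ (t u) s * bs i) := by
  have hD := (denom_pos hU hφ hn ha hbs htu hy hyU hF hg hs hφ0).ne'
  have hH : Hfun φ (t u) s *
      (2 * (φ (t u) s - s * D2 φ (t u) s + (t u - s ^ 2) * D2 (D2 φ) (t u) s))
      = D2 (D2 φ) (t u) s - 2 * (D1 φ (t u) s - s * D2 (D1 φ) (t u) s) :=
    div_mul_cancel₀ _ (mul_ne_zero two_ne_zero hD)
  have hE : Efun φ (t u) s * (2 * φ (t u) s) = D2 φ (t u) s + 2 * s * D1 φ (t u) s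
      - 2 * Hfun φ (t u) s * (s * φ (t u) s + (t u - s ^ 2) * D2 φ (t u) s) := by
    simp only [Efun]; field_simp
  have hsym := isSymm_of_posDef ha
  have hA := qf_pos ha hy
  have hp : 0 < (lagArg a b t u y).2.1 := hA
  have hlag := eventually_hasFDerivAt_lag hU hφ hp hyU
  have hα : 0 < √(qf (a u) y) := Real.sqrt_pos.2 hA
  have hL := hasFDerivAt_lag hU hφ hp hyU (t := t u) (α := √(qf (a u) y)) (s := s)
    rfl rfl hs rfl rfl rfl
  have hLA := hasFDerivAt_lagA hU hφ hp hyU (t := t u) (α := √(qf (a u) y)) (s := s)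
    rfl rfl hs rfl rfl rfl rfl rfl
  have hLB := hasFDerivAt_lagB hU hφ hp hyU (t := t u) (α := √(qf (a u) y)) (s := s)
    rfl rfl hs rfl rfl rfl rfl rfl
  have hvA : lagA φ (lagArg a b t u y) = φ (t u) s ^ 2 - s * (φ (t u) s * D2 φ (t u) s) := by
    rw [hs]; rfl
  have hvB : lagB φ (lagArg a b t u y) = 2 * √(qf (a u) y) * (φ (t u) s * D2 φ (t u) s) := by
    rw [hs]; rfl
  have hsq : qf (a u) y = √(qf (a u) y) ^ 2 := (Real.sq_sqrt hA.le).symm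
  have hB : lf (b u) y = s * √(qf (a u) y) := by rw [hs]; field_simp
  have hgu : IsUnit (fundamentalTensor F u y).det := hg.det_pos.ne'.isUnit
  refine spray_eq_of_hasFDerivAt haD hbD ha.det_pos.ne'.isUnit has ht hFw hA hlag hL hLA hLB
    ?_ ?_ hcov hdt hbs htu hgu ?_ ?_ i
  · rw [hB]
    generalize √(qf (a u) y) = α at *
    rw [hsq]
    field_simp; ring
  · rw [hB, hvB]
    generalize √(qf (a u) y) = α at *
    rw [hsq]
    field_simp; ring
  · rw [hB, hvA]
    clear hg hgu hL hLA hLB hlag hvA hvB hs hyU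
    generalize √(qf (a u) y) = α at *
    rw [hsq]
    field_simp
    linear_combination (φ (t u) s - s * D2 φ (t u) s) * hE - (s * φ (t u) s) * hH
  · rw [hB, hvA, hvB]
    clear hg hgu hL hLA hLB hlag hvA hvB hs hyU
    generalize √(qf (a u) y) = α at *
    rw [hsq]
    field_simp
    linear_combination D2 φ (t u) s * hE + φ (t u) s * hH

end

end

/-! ### Third derivatives in the fibre directions -/

section

variable {n : ℕ}

/-- The partial derivative `∂f/∂yⁱ`. -/
def dy (i : Fin n) (f : Coord n → ℝ) (y : Coord n) : ℝ :=
  fderiv ℝ f y (EuclideanSpace.single i 1)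

/-- The third partial derivative `∂³f/∂yʲ∂yᵏ∂yˡ`. -/
def dyyy (j k l : Fin n) (f : Coord n → ℝ) : Coord n → ℝ := dy l (dy k (dy j f))

theorem dy_congr {f g : Coord n → ℝ} {y : Coord n} (h : f =ᶠ[nhds y] g) (i : Fin n) :
    dy i f =ᶠ[nhds y] dy i g := by
  filter_upwards [h.fderiv (𝕜 := ℝ)] with x hx
  simp [dy, hx]

theorem dyyy_congr {f g : Coord n → ℝ} {y : Coord n} (h : f =ᶠ[nhds y] g) (j k l : Fin n) :
    dyyy j k l f y = dyyy j k l g y :=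
  (dy_congr (dy_congr (dy_congr h j) k) l).eq_of_nhds

theorem sum_smul_single (y : Coord n) :
    y = ∑ i, y i • EuclideanSpace.single i (1 : ℝ) := by
  ext j; simp [Finset.sum_apply, Pi.single_apply]

theorem fderiv_eq_sum_dy (f : Coord n → ℝ) (y v : Coord n) :
    fderiv ℝ f y v = ∑ i, v i * dy i f y := by
  conv_lhs => rw [sum_smul_single v]
  simp [dy]

section smooth
variable {S : Set (Coord n)} (hS : IsOpen S) {f g : Coord n → ℝ}
  (hf : ContDiffOn ℝ ∞ f S) (hg : ContDiffOn ℝ ∞ g S)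
include hS

theorem eqOn_dy (h : Set.EqOn f g S) (i : Fin n) : Set.EqOn (dy i f) (dy i g) S := fun _ hy =>
  (dy_congr (h.eventuallyEq_of_mem (hS.mem_nhds hy)) i).eq_of_nhds

include hf

theorem contDiffOn_dy (i : Fin n) : ContDiffOn ℝ ∞ (dy i f) S :=
  (hf.fderiv_of_isOpen hS (m := ∞) le_rfl).clm_apply contDiffOn_const

theorem differentiableAt_of_contDiffOn {y : Coord n} (hy : y ∈ S) : DifferentiableAt ℝ f y :=
  (hf.differentiableOn (by simp)).differentiableAt (hS.mem_nhds hy)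

theorem dy_dy_comm {y : Coord n} (hy : y ∈ S) (i j : Fin n) :
    dy i (dy j f) y = dy j (dy i f) y := by
  have hd : DifferentiableAt ℝ (fderiv ℝ f) y :=
    ((hf.fderiv_of_isOpen hS (m := ∞) le_rfl).differentiableOn (by simp)).differentiableAt
      (hS.mem_nhds hy)
  have e : ∀ p q : Fin n, dy p (dy q f) y
      = fderiv ℝ (fderiv ℝ f) y (EuclideanSpace.single p 1) (EuclideanSpace.single q 1) := by
    intro p q
    have h := hd.hasFDerivAt.clm_apply
      (hasFDerivAt_const (EuclideanSpace.single q (1 : ℝ) : Coord n) y)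
    unfold dy
    rw [h.fderiv]
    simp
  have hsymm : IsSymmSndFDerivAt ℝ f y := (hf.contDiffAt (hS.mem_nhds hy)).isSymmSndFDerivAt (by
    rw [minSmoothness_of_isRCLikeNormedField]; exact WithTop.coe_le_coe.2 le_top)
  rw [e, e, hsymm]

theorem eqOn_dy_const_mul (r : ℝ) (i : Fin n) :
    Set.EqOn (dy i (fun y => r * f y)) (fun y => r * dy i f y) S := fun y hy => by
  simp only [dy]
  rw [fderiv_const_mul (differentiableAt_of_contDiffOn hS hf hy)]
  simp

theorem eqOn_dyyy_const_mul (r : ℝ) (j k l : Fin n) :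
    Set.EqOn (dyyy j k l (fun y => r * f y)) (fun y => r * dyyy j k l f y) S := by
  have h1 := contDiffOn_dy hS hf j
  have h2 := contDiffOn_dy hS h1 k
  exact (eqOn_dy hS ((eqOn_dy hS (eqOn_dy_const_mul hS hf r j) k).trans
    (eqOn_dy_const_mul hS h1 r k)) l).trans (eqOn_dy_const_mul hS h2 r l)

theorem eqOn_dy_mul_coord (i k : Fin n) :
    Set.EqOn (dy k (fun y => f y * y i))
      (fun y => dy k f y * y i + f y * (if i = k then 1 else 0)) S := fun y hy => by
  have h := (differentiableAt_of_contDiffOn hS hf hy).hasFDerivAt.mul (hasFDerivAt_coord i y)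
  simp only [dy]
  erw [h.fderiv]
  simp
  ring

include hg

theorem eqOn_dy_add (i : Fin n) :
    Set.EqOn (dy i (fun y => f y + g y)) (fun y => dy i f y + dy i g y) S := fun y hy => by
  simp only [dy]
  rw [fderiv_fun_add (differentiableAt_of_contDiffOn hS hf hy)
    (differentiableAt_of_contDiffOn hS hg hy)]
  simp

theorem eqOn_dyyy_add (j k l : Fin n) :
    Set.EqOn (dyyy j k l (fun y => f y + g y)) (fun y => dyyy j k l f y + dyyy j k l g y) S := by
  have f1 := contDiffOn_dy hS hf j
  have f2 := contDiffOn_dy hS f1 k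
  have g1 := contDiffOn_dy hS hg j
  have g2 := contDiffOn_dy hS g1 k
  exact (eqOn_dy hS ((eqOn_dy hS (eqOn_dy_add hS hf hg j) k).trans
    (eqOn_dy_add hS f1 g1 k)) l).trans (eqOn_dy_add hS f2 g2 l)

omit hg

/-- The third derivatives of `f yⁱ`; for `f = F` the right-hand side is the isotropic tensor. -/
theorem dyyy_mul_coord {y : Coord n} (hy : y ∈ S) (i j k l : Fin n) :
    dyyy j k l (fun y => f y * y i) y
      = dy k (dy j f) y * (if i = l then 1 else 0) + dy l (dy j f) y * (if i = k then 1 else 0)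
        + dy k (dy l f) y * (if i = j then 1 else 0) + dyyy j k l f y * y i := by
  have f1 := contDiffOn_dy hS hf j
  have f2 := contDiffOn_dy hS f1 k
  have fk := contDiffOn_dy hS hf k
  have hc : ∀ (p : Fin n) {h : Coord n → ℝ}, ContDiffOn ℝ ∞ h S →
      ContDiffOn ℝ ∞ (fun y => h y * y p) S := fun p h hh =>
    hh.mul (EuclideanSpace.proj p : Coord n →L[ℝ] ℝ).contDiff.contDiffOn
  have hr : ∀ (r : ℝ) {h : Coord n → ℝ}, ContDiffOn ℝ ∞ h S →
      ContDiffOn ℝ ∞ (fun y => h y * r) S := fun r h hh => hh.mul contDiffOn_const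
  have e0 : ∀ (r : ℝ) {h : Coord n → ℝ} (_ : ContDiffOn ℝ ∞ h S) (p : Fin n),
      Set.EqOn (dy p (fun y => h y * r)) (fun y => dy p h y * r) S := by
    intro r h hh p
    simpa only [mul_comm _ r] using eqOn_dy_const_mul hS hh r p
  have e1 := eqOn_dy_mul_coord hS hf i j
  have e2 : Set.EqOn (dy k (dy j (fun y => f y * y i)))
      (fun y => (dy k (dy j f) y * y i + dy j f y * (if i = k then 1 else 0))
        + dy k f y * (if i = j then 1 else 0)) S :=
    ((eqOn_dy hS e1 k).trans (eqOn_dy_add hS (hc i f1) (hr _ hf) k)).trans fun x hx => by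
      simp only [eqOn_dy_mul_coord hS f1 i k hx, e0 _ hf k hx]
  have e3 := ((eqOn_dy hS e2 l).trans
    (eqOn_dy_add hS ((hc i f2).add (hr (if i = k then 1 else 0) f1)) (hr _ fk) l)) hy
  rw [dyyy, e3]
  simp only [eqOn_dy_add hS (hc i f2) (hr (if i = k then 1 else 0) f1) l hy,
    eqOn_dy_mul_coord hS f2 i l hy, e0 _ f1 l hy, e0 _ fk l hy, dyyy, dy_dy_comm hS hf hy l k]
  ring

end smooth

theorem dyyy_qf (M : Matrix (Fin n) (Fin n) ℝ) (j k l : Fin n) (y : Coord n) :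
    dyyy j k l (qf M) y = 0 := by
  have h1 : dy j (qf M) = lf (fun i => M i j + M j i) := by
    funext y
    rw [dy, (hasFDerivAt_qf M y).fderiv]
    simp [Finset.sum_add_distrib, add_mul, lf]
  have h2 : dy k (lf (fun i => M i j + M j i)) = fun _ => M k j + M j k := by
    funext y
    exact fderiv_lf_single _ y k
  rw [dyyy, h1, h2]
  simp [dy]

theorem contDiff_qf (M : Matrix (Fin n) (Fin n) ℝ) : ContDiff ℝ ∞ (qf M) :=
  ContDiff.sum fun i _ => ContDiff.sum fun j _ => contDiff_const.mul
    ((EuclideanSpace.proj i : Coord n →L[ℝ] ℝ).contDiff.mul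
      (EuclideanSpace.proj j : Coord n →L[ℝ] ℝ).contDiff)

theorem contDiff_lf (b : Fin n → ℝ) : ContDiff ℝ ∞ (lf b) :=
  ContDiff.sum fun i _ => contDiff_const.mul (EuclideanSpace.proj i : Coord n →L[ℝ] ℝ).contDiff

section homogeneous
variable {S : Set (Coord n)} (hS : IsOpen S) {f : Coord n → ℝ} (hf : ContDiffOn ℝ ∞ f S)
  (hcone : ∀ y ∈ S, ∀ r : ℝ, 0 < r → r • y ∈ S)
include hS hf

/-- Euler's theorem on homogeneous functions. -/
theorem euler {d : ℕ} (hd : ∀ y ∈ S, ∀ r : ℝ, 0 < r → f (r • y) = r ^ d * f y) {y : Coord n}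
    (hy : y ∈ S) : ∑ i, y i * dy i f y = d * f y := by
  have h1 : HasDerivAt (fun r : ℝ => r • y) y 1 := by
    simpa using (hasDerivAt_id (1 : ℝ)).smul_const y
  have h2 : HasFDerivAt f (fderiv ℝ f y) ((1 : ℝ) • y) := by
    rw [one_smul]; exact (differentiableAt_of_contDiffOn hS hf hy).hasFDerivAt
  have h3 := h2.comp_hasDerivAt (1 : ℝ) h1
  have h4 : HasDerivAt (fun r : ℝ => r ^ d * f y) (d * f y) 1 := by
    simpa using (hasDerivAt_pow d (1 : ℝ)).mul_const (f y)
  rw [← fderiv_eq_sum_dy]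
  refine h3.unique (h4.congr_of_eventuallyEq ?_)
  filter_upwards [lt_mem_nhds (zero_lt_one (α := ℝ))] with r hr using hd y hy r hr

include hcone

/-- The derivatives of a homogeneous function are homogeneous, of one degree less. -/
theorem dy_homogeneous {d : ℕ} (hd : ∀ y ∈ S, ∀ r : ℝ, 0 < r → f (r • y) = r ^ (d + 1) * f y)
    (i : Fin n) : ∀ y ∈ S, ∀ r : ℝ, 0 < r → dy i f (r • y) = r ^ d * dy i f y := by
  intro y hy r hr
  have h1 : HasFDerivAt (fun y : Coord n => r • y) (r • ContinuousLinearMap.id ℝ (Coord n)) y :=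
    (hasFDerivAt_id y).const_smul r
  have h2 := (differentiableAt_of_contDiffOn hS hf (hcone y hy r hr)).hasFDerivAt.comp y h1
  have h3 := (differentiableAt_of_contDiffOn hS hf hy).hasFDerivAt.const_mul (r ^ (d + 1))
  have h4 := h2.unique (h3.congr_of_eventuallyEq (by
    filter_upwards [hS.mem_nhds hy] with x hx using hd x hx r hr))
  have h5 := congrArg (fun l => l (EuclideanSpace.single i (1 : ℝ))) h4
  simp only [ContinuousLinearMap.comp_apply, _root_.smul_apply, ContinuousLinearMap.id_apply,
    map_smul, smul_eq_mul] at h5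
  have h6 : r * dy i f (r • y) = r * (r ^ d * dy i f y) := by
    simp only [dy]; rw [h5]; ring
  exact mul_left_cancel₀ hr.ne' h6

/-- Along a path in a domain where its third derivatives vanish, a `2`-homogeneous function
is given by a fixed quadratic form: its Hessian is constant along the path. -/
theorem exists_eq_qf_of_dyyy_eq_zero
    (hd : ∀ y ∈ S, ∀ r : ℝ, 0 < r → f (r • y) = r ^ 2 * f y)
    (hz : ∀ y ∈ S, ∀ j k l, dyyy j k l f y = 0) {γ γ' : ℝ → Coord n} {p q : ℝ}
    (hγ : ∀ θ, HasDerivAt γ (γ' θ) θ) (hγS : ∀ θ ∈ Set.Icc p q, γ θ ∈ S) :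
    ∃ M : Matrix (Fin n) (Fin n) ℝ, ∀ θ ∈ Set.Icc p q, f (γ θ) = qf M (γ θ) := by
  refine ⟨Matrix.of fun j k => (1 / 2) * dy k (dy j f) (γ p), fun θ hθ => ?_⟩
  have hconst : ∀ j k, dy k (dy j f) (γ θ) = dy k (dy j f) (γ p) := by
    intro j k
    have hsm := contDiffOn_dy hS (contDiffOn_dy hS hf j) k
    have hder : ∀ x ∈ Set.Icc p q, HasDerivAt (fun θ => dy k (dy j f) (γ θ)) 0 x := by
      intro x hx
      have h := (differentiableAt_of_contDiffOn hS hsm (hγS x hx)).hasFDerivAt.comp_hasDerivAt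
        x (hγ x)
      have e : fderiv ℝ (dy k (dy j f)) (γ x) (γ' x) = 0 := by
        rw [fderiv_eq_sum_dy]
        exact Finset.sum_eq_zero fun l _ => by
          rw [show dy l (dy k (dy j f)) (γ x) = 0 from hz _ (hγS x hx) j k l, mul_zero]
      rw [e] at h
      exact h
    exact constant_of_has_deriv_right_zero
      (fun x hx => (hder x hx).continuousAt.continuousWithinAt)
      (fun x hx => (hder x (Set.Ico_subset_Icc_self hx)).hasDerivWithinAt) θ hθ
  -- Euler's theorem, for `f` and for its first derivatives, recovers `f` from its Hessian
  have hy := hγS θ hθ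
  have h1 := euler hS hf hd hy
  have h2 := fun j => euler hS (contDiffOn_dy hS hf j) (d := 1)
    (dy_homogeneous hS hf hcone hd j) hy
  have h3 : qf (Matrix.of fun j k => (1 / 2) * dy k (dy j f) (γ p)) (γ θ)
      = (1 / 2) * ∑ j, γ θ j * ∑ k, γ θ k * dy k (dy j f) (γ θ) := by
    simp only [qf, Matrix.of_apply, ← hconst, Finset.mul_sum]
    exact Finset.sum_congr rfl fun i _ => Finset.sum_congr rfl fun j _ => by ring
  rw [h3]
  simp only [h2]
  simp only [Nat.cast_one, one_mul]
  rw [h1]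
  push_cast; ring

end homogeneous

end

/-! ### The vector field `α f(s) y + α² h(s) b`: sufficiency of the differential equations -/

section

variable {n : ℕ}

/-- On an interval, the solutions of `f = s f'` are the linear functions. -/
theorem exists_eq_mul_of_eq_mul_deriv {I : Set ℝ} (hI : I.OrdConnected) {f : ℝ → ℝ}
    (hd : ∀ s ∈ I, DifferentiableAt ℝ f s) (hf : ∀ s ∈ I, f s - s * deriv f s = 0) :
    ∃ l, ∀ s ∈ I, f s = l * s := by
  by_cases h0 : (0 : ℝ) ∈ I
  · refine ⟨deriv f 0, fun s hs => ?_⟩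
    have f0 : f 0 = 0 := by simpa using hf 0 h0
    have hmem : ∀ x ∈ Set.Icc (0 : ℝ) 1, s * x ∈ I := by
      intro x hx
      refine hI.uIcc_subset h0 hs ?_
      rcases le_total 0 s with h | h
      · rw [Set.uIcc_of_le h]
        exact ⟨mul_nonneg h hx.1, mul_le_of_le_one_right h hx.2⟩
      · rw [Set.uIcc_of_ge h]
        exact ⟨by nlinarith [hx.2], mul_nonpos_of_nonpos_of_nonneg h hx.1⟩
    -- `f(s x) / x` is constant for `0 < x ≤ 1`, and its limit at `0` is `f'(0) s`
    have hconst : ∀ x ∈ Set.Ioc (0 : ℝ) 1, x⁻¹ * f (s * x) = f s := by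
      intro x hx
      have hder : ∀ z ∈ Set.Icc x 1, HasDerivAt (fun z => z⁻¹ * f (s * z)) 0 z := by
        intro z hz
        have hz0 : 0 < z := hx.1.trans_le hz.1
        have hm := hmem z ⟨hz0.le, hz.2⟩
        have h1 : HasDerivAt (fun z => s * z) s z := by
          simpa using (hasDerivAt_id z).const_mul s
        have h2 := (hasDerivAt_inv hz0.ne').mul
          ((hd _ hm).hasDerivAt.comp z h1)
        refine h2.congr_deriv ?_
        have := hf _ hm
        simp only [Function.comp]
        generalize deriv f (s * z) = B at *
        generalize f (s * z) = A at *
        field_simp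
        linear_combination (-1 : ℝ) * this
      have := constant_of_has_deriv_right_zero
        (fun z hz => (hder z hz).continuousAt.continuousWithinAt)
        (fun z hz => (hder z (Set.Ico_subset_Icc_self hz)).hasDerivWithinAt) 1
        (Set.right_mem_Icc.2 hx.2)
      simpa using this.symm
    have h1 : HasDerivAt (fun x => f (s * x)) (deriv f 0 * s) 0 := by
      have e : HasDerivAt (fun z => s * z) s 0 := by
        simpa using (hasDerivAt_id (0 : ℝ)).const_mul s
      have e2 : HasDerivAt f (deriv f 0) (s * 0) := by rw [mul_zero]; exact (hd 0 h0).hasDerivAt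
      exact e2.comp 0 e
    have h2 := (hasDerivAt_iff_tendsto_slope_zero.1 h1).mono_left
      (nhdsWithin_mono 0 (fun x (hx : x ∈ Set.Ioi (0 : ℝ)) => (ne_of_gt hx : x ≠ 0)))
    refine tendsto_nhds_unique ((tendsto_const_nhds (x := f s)).congr' ?_) h2
    filter_upwards [Ioc_mem_nhdsGT (zero_lt_one (α := ℝ))] with x hx
    simp [f0, hconst x hx]
  · -- `f(s) / s` is constant
    rcases I.eq_empty_or_nonempty with rfl | ⟨p, hp⟩
    · exact ⟨0, by simp⟩
    refine ⟨f p / p, fun s hs => ?_⟩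
    have hmem : ∀ x ∈ Set.Icc (0 : ℝ) 1, p + (s - p) * x ∈ I := by
      intro x hx
      refine hI.uIcc_subset hp hs ?_
      rcases le_total p s with h | h
      · rw [Set.uIcc_of_le h]
        exact ⟨by nlinarith [hx.1], by nlinarith [hx.2]⟩
      · rw [Set.uIcc_of_ge h]
        exact ⟨by nlinarith [hx.2], by nlinarith [hx.1]⟩
    have hne : ∀ z ∈ I, z ≠ 0 := fun z hz h => h0 (h ▸ hz)
    have hder : ∀ z ∈ Set.Icc (0 : ℝ) 1,
        HasDerivAt (fun z => (p + (s - p) * z)⁻¹ * f (p + (s - p) * z)) 0 z := by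
      intro z hz
      have hm := hmem z hz
      have hm0 := hne _ hm
      have h1 : HasDerivAt (fun z => p + (s - p) * z) (s - p) z := by
        simpa using ((hasDerivAt_id z).const_mul (s - p)).const_add p
      have h2 := ((hasDerivAt_inv hm0).comp z h1).mul ((hd _ hm).hasDerivAt.comp z h1)
      refine h2.congr_deriv ?_
      have := hf _ hm
      simp only [Function.comp]
      field_simp
      linear_combination (-1 : ℝ) * (s - p) * this
    have := constant_of_has_deriv_right_zero
      (fun z hz => (hder z hz).continuousAt.continuousWithinAt)
      (fun z hz => (hder z (Set.Ico_subset_Icc_self hz)).hasDerivWithinAt) 1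
      (Set.right_mem_Icc.2 zero_le_one)
    have hs0 := hne s hs
    have hp0 := hne p hp
    simp at this
    field_simp at this ⊢
    linarith

/-- On an interval, the solutions of `h' = s h''` are the polynomials `m + k s²`. -/
theorem exists_eq_add_mul_sq {I : Set ℝ} (hI : I.OrdConnected) {h : ℝ → ℝ}
    (hd : ∀ s ∈ I, DifferentiableAt ℝ h s) (hd2 : ∀ s ∈ I, DifferentiableAt ℝ (deriv h) s)
    (hh : ∀ s ∈ I, deriv h s - s * deriv (deriv h) s = 0) :
    ∃ m k, ∀ s ∈ I, h s = m + k * s ^ 2 := by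
  obtain ⟨l, hl⟩ := exists_eq_mul_of_eq_mul_deriv hI hd2 hh
  have hder : ∀ s ∈ I, HasDerivAt (fun s => h s - l / 2 * s ^ 2) 0 s := by
    intro s hs
    have h1 := (hd s hs).hasDerivAt.sub ((hasDerivAt_pow 2 s).const_mul (l / 2))
    refine h1.congr_deriv ?_
    rw [hl s hs]; norm_num; ring
  have key : ∀ p ∈ I, ∀ q ∈ I, p ≤ q → h q - l / 2 * q ^ 2 = h p - l / 2 * p ^ 2 := by
    intro p hp q hq hpq
    exact constant_of_has_deriv_right_zero
      (fun z hz => (hder z (hI.out hp hq hz)).continuousAt.continuousWithinAt)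
      (fun z hz => (hder z (hI.out hp hq (Set.Ico_subset_Icc_self hz))).hasDerivWithinAt) q
      (Set.right_mem_Icc.2 hpq)
  rcases I.eq_empty_or_nonempty with rfl | ⟨p, hp⟩
  · exact ⟨0, 0, by simp⟩
  refine ⟨h p - l / 2 * p ^ 2, l / 2, fun s hs => ?_⟩
  rcases le_total p s with hps | hps
  · linarith [key p hp s hs hps]
  · linarith [key s hs p hp hps]

/-- The domain of a function `f (β / α)` of tangent vectors at a fixed point. -/
def ratioDomain (M : Matrix (Fin n) (Fin n) ℝ) (b : Fin n → ℝ) (V : Set ℝ) : Set (Coord n) :=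
  {y | y ≠ 0 ∧ lf b y / √(qf M y) ∈ V}

/-- The components of the vector field `α f(β / α) y + α² h(β / α) b` on a tangent space, where `bs`
is the vector dual to the covector `b`. -/
def abField (M : Matrix (Fin n) (Fin n) ℝ) (b : Fin n → ℝ) (bs : Coord n) (f h : ℝ → ℝ)
    (i : Fin n) (y : Coord n) : ℝ :=
  √(qf M y) * f (lf b y / √(qf M y)) * y i + qf M y * h (lf b y / √(qf M y)) * bs i

section
variable {M : Matrix (Fin n) (Fin n) ℝ} (hM : M.PosDef) {b : Fin n → ℝ} {bs : Coord n}
  {V : Set ℝ} (hV : IsOpen V) {f h : ℝ → ℝ} (hf : ContDiffOn ℝ ∞ f V) (hh : ContDiffOn ℝ ∞ h V)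

theorem ratio_smul (y : Coord n) {r : ℝ} (hr : 0 < r) :
    lf b (r • y) / √(qf M (r • y)) = lf b y / √(qf M y) := by
  rw [lf_smul, qf_smul, Real.sqrt_mul (sq_nonneg r), Real.sqrt_sq hr.le,
    mul_div_mul_left _ _ hr.ne']

theorem smul_mem_ratioDomain {y : Coord n} (hy : y ∈ ratioDomain M b V) {r : ℝ} (hr : 0 < r) :
    r • y ∈ ratioDomain M b V :=
  ⟨smul_ne_zero hr.ne' hy.1, by rw [ratio_smul y hr]; exact hy.2⟩

theorem abField_smul (i : Fin n) (y : Coord n) {r : ℝ} (hr : 0 < r) :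
    abField M b bs f h i (r • y) = r ^ 2 * abField M b bs f h i y := by
  rw [abField, ratio_smul y hr, qf_smul, Real.sqrt_mul (sq_nonneg r), Real.sqrt_sq hr.le,
    abField]
  simp only [PiLp.smul_apply, smul_eq_mul]
  ring

include hM

theorem contDiffOn_sqrt_qf : ContDiffOn ℝ ∞ (fun y : Coord n => √(qf M y)) {0}ᶜ :=
  (contDiff_qf M).contDiffOn.sqrt fun _ hy => (qf_pos hM hy).ne'

theorem contDiffOn_ratio :
    ContDiffOn ℝ ∞ (fun y : Coord n => lf b y / √(qf M y)) {0}ᶜ :=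
  (contDiff_lf b).contDiffOn.div (contDiffOn_sqrt_qf hM)
    fun _ hy => (Real.sqrt_pos.2 (qf_pos hM hy)).ne'

include hV in
theorem isOpen_ratioDomain : IsOpen (ratioDomain M b V) :=
  (contDiffOn_ratio hM).continuousOn.isOpen_inter_preimage isOpen_compl_singleton hV

theorem contDiffOn_comp_ratio {f : ℝ → ℝ} (hf : ContDiffOn ℝ ∞ f V) :
    ContDiffOn ℝ ∞ (fun y => f (lf b y / √(qf M y))) (ratioDomain M b V) :=
  hf.comp ((contDiffOn_ratio hM).mono fun _ hy => hy.1) fun _ hy => hy.2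

theorem contDiffOn_sqrt_mul_comp_ratio {f : ℝ → ℝ} (hf : ContDiffOn ℝ ∞ f V) :
    ContDiffOn ℝ ∞ (fun y => √(qf M y) * f (lf b y / √(qf M y))) (ratioDomain M b V) :=
  ((contDiffOn_sqrt_qf hM).mono fun _ hy => hy.1).mul (contDiffOn_comp_ratio hM hf)

include hf hh in
theorem contDiffOn_abField (i : Fin n) :
    ContDiffOn ℝ ∞ (abField M b bs f h i) (ratioDomain M b V) :=
  ((contDiffOn_sqrt_mul_comp_ratio hM hf).mul
    (EuclideanSpace.proj i : Coord n →L[ℝ] ℝ).contDiff.contDiffOn).add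
  (((contDiff_qf M).contDiffOn.mul (contDiffOn_comp_ratio hM hh)).mul contDiffOn_const)

section sufficiency
variable (hbs : ∀ i, lower M bs i = b i)
include hbs

theorem sq_ratio_le {y : Coord n} (hy : y ≠ 0) : (lf b y / √(qf M y)) ^ 2 ≤ lf b bs := by
  have h1 := qf_pos hM hy
  rw [div_pow, Real.sq_sqrt h1.le, div_le_iff₀ h1]
  exact sq_lf_le hM hbs y

include hV hf hh

/-- If `f - s f' = 0` and `h' - s h'' = 0`, the field `α f y + α² h b` is locally quadratic. -/
theorem dyyy_abField_eq_zero
    (h1 : ∀ s ∈ V, s ^ 2 ≤ lf b bs → f s - s * deriv f s = 0)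
    (h2 : ∀ s ∈ V, s ^ 2 ≤ lf b bs → deriv h s - s * deriv (deriv h) s = 0)
    {y : Coord n} (hy : y ∈ ratioDomain M b V) (i j k l : Fin n) :
    dyyy j k l (abField M b bs f h i) y = 0 := by
  set s0 := lf b y / √(qf M y) with hs0
  obtain ⟨ε, hε, hball⟩ := Metric.isOpen_iff.1 hV s0 hy.2
  -- the equations are known only for `s² ≤ b²`, and `s` takes only such values
  set I := Metric.ball s0 ε ∩ Set.Icc (-√(lf b bs)) (√(lf b bs)) with hI
  have hIsq : ∀ s ∈ I, s ^ 2 ≤ lf b bs := fun s hs => by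
    have hn : 0 ≤ lf b bs := (sq_nonneg _).trans (sq_ratio_le hM hbs hy.1)
    rw [← Real.sq_sqrt hn]
    exact sq_le_sq' hs.2.1 hs.2.2
  have hIc : I.OrdConnected := by
    rw [hI, Real.ball_eq_Ioo]
    exact Set.ordConnected_Ioo.inter Set.ordConnected_Icc
  have hd : ∀ {g : ℝ → ℝ}, ContDiffOn ℝ ∞ g V → ∀ s ∈ I, DifferentiableAt ℝ g s :=
    fun hg s hs => (hg.differentiableOn (by simp)).differentiableAt
      (hV.mem_nhds (hball hs.1))
  have hdh : ContDiffOn ℝ ∞ (deriv h) V := hh.deriv_of_isOpen hV (m := ∞) le_rfl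
  obtain ⟨q, hq⟩ := exists_eq_mul_of_eq_mul_deriv hIc (hd hf)
    fun s hs => h1 s (hball hs.1) (hIsq s hs)
  obtain ⟨m, p, hp⟩ := exists_eq_add_mul_sq hIc (hd hh) (hd hdh)
    fun s hs => h2 s (hball hs.1) (hIsq s hs)
  have hev : abField M b bs f h i =ᶠ[nhds y] qf (Matrix.of fun r t =>
      q * (b r * if t = i then 1 else 0) + (m * M r t + p * (b r * b t)) * bs i) := by
    have hc : ContinuousAt (fun y => lf b y / √(qf M y)) y :=
      (contDiffOn_ratio hM).continuousOn.continuousAt (isOpen_compl_singleton.mem_nhds hy.1)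
    filter_upwards [hc.eventually (Metric.ball_mem_nhds s0 hε),
      isOpen_compl_singleton.mem_nhds hy.1] with x hx hx0
    have hxI : lf b x / √(qf M x) ∈ I := ⟨hx, by
      rw [Set.mem_Icc, ← abs_le]
      exact Real.abs_le_sqrt (sq_ratio_le hM hbs hx0)⟩
    have hA := qf_pos hM hx0
    have hα := Real.sqrt_pos.2 hA
    have e : qf (Matrix.of fun r t =>
        q * (b r * if t = i then 1 else 0) + (m * M r t + p * (b r * b t)) * bs i) x
        = q * (lf b x * x i) + (m * qf M x + p * lf b x ^ 2) * bs i := by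
      have e1 : lf b x * x i = ∑ r, ∑ t, (b r * if t = i then 1 else 0) * (x r * x t) := by
        simp only [lf, Finset.sum_mul]
        refine Finset.sum_congr rfl fun r _ => ?_
        simp
        ring
      have e2 : lf b x ^ 2 = ∑ r, ∑ t, (b r * b t) * (x r * x t) := by
        rw [sq, lf, Finset.sum_mul_sum]
        exact Finset.sum_congr rfl fun r _ => Finset.sum_congr rfl fun t _ => by ring
      rw [e1, e2]
      simp only [qf, Matrix.of_apply, Finset.mul_sum, Finset.sum_mul, ← Finset.sum_add_distrib]
      exact Finset.sum_congr rfl fun r _ => Finset.sum_congr rfl fun t _ => by ring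
    rw [e, abField, hq _ hxI, hp _ hxI]
    have hsq : qf M x = √(qf M x) ^ 2 := (Real.sq_sqrt hA.le).symm
    generalize √(qf M x) = α at *
    rw [hsq]
    field_simp
  rw [dyyy_congr hev, dyyy_qf]

end sufficiency

end

end

/-! ### The vector field `α f(s) y + α² h(s) b`: necessity of the differential equations -/

section

variable {n : ℕ}

section
variable {M : Matrix (Fin n) (Fin n) ℝ} (hM : M.PosDef) {b : Fin n → ℝ} {bs : Coord n}
  (hbs : ∀ i, lower M bs i = b i)
  {V : Set ℝ} (hV : IsOpen V) {f h : ℝ → ℝ} (hf : ContDiffOn ℝ ∞ f V) (hh : ContDiffOn ℝ ∞ h V)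
  (hz : ∀ y ∈ ratioDomain M b V, ∀ i j k l, dyyy j k l (abField M b bs f h i) y = 0)

include hM hbs in
/-- Every value `s` with `s² ≤ ‖b‖²` is taken on a unit vector. -/
theorem exists_unit_lf_eq (hn : 2 ≤ n) {s : ℝ} (hs : s ^ 2 ≤ lf b bs) :
    ∃ y : Coord n, qf M y = 1 ∧ lf b y = s := by
  have hsym := isSymm_of_posDef hM
  have hqb : qf M bs = lf b bs := by rw [← bf_self, bf_dual_left hbs]
  obtain ⟨v, hv, hbv⟩ := exists_unit_orth hM (m := 1) (by omega) (fun _ => b)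
  replace hbv := hbv 0
  rcases ((sq_nonneg s).trans hs).eq_or_lt with ht | ht
  · refine ⟨v, hv, ?_⟩
    rw [← ht] at hs
    rw [hbv, pow_eq_zero_iff two_ne_zero |>.1 (le_antisymm hs (sq_nonneg s))]
  · set t := lf b bs with ht_def
    have h1 : 0 ≤ 1 - s ^ 2 / t := by rw [sub_nonneg, div_le_one ht]; exact hs
    refine ⟨(s / t) • bs + √(1 - s ^ 2 / t) • v, ?_, ?_⟩
    · rw [qf_add hsym, qf_smul, qf_smul, hqb, hv, bf_smul_left hsym, bf_smul_right,
        bf_dual_left hbs, hbv, Real.sq_sqrt h1]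
      field_simp; ring
    · rw [lf_add, lf_smul, lf_smul, hbv, ← ht_def]; field_simp; ring

include hM hV hf hh hz

/-- Along an arc `cos θ y₀ + sin θ v`, the field `α f y + α² h b` is a quadratic form in
`(cos θ, sin θ)` if its third derivatives vanish. -/
theorem abField_arc {y0 v : Coord n} {q : ℝ}
    (hS : ∀ θ ∈ Set.Icc (-q) q, Real.cos θ • y0 + Real.sin θ • v ∈ ratioDomain M b V)
    (w : Fin n → ℝ) : ∃ X Y Z : ℝ, ∀ θ ∈ Set.Icc (-q) q,
      ∑ i, w i * abField M b bs f h i (Real.cos θ • y0 + Real.sin θ • v)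
        = X * Real.cos θ ^ 2 + Y * (Real.cos θ * Real.sin θ) + Z * Real.sin θ ^ 2 := by
  have hγ : ∀ θ, HasDerivAt (fun θ => Real.cos θ • y0 + Real.sin θ • v)
      (-Real.sin θ • y0 + Real.cos θ • v) θ := fun θ =>
    ((Real.hasDerivAt_cos θ).smul_const y0).add ((Real.hasDerivAt_sin θ).smul_const v)
  choose N hN using fun i => exists_eq_qf_of_dyyy_eq_zero (isOpen_ratioDomain hM hV)
    (contDiffOn_abField hM (bs := bs) hf hh i) (fun y hy r hr => smul_mem_ratioDomain hy hr)
    (fun y _ r hr => abField_smul i y hr) (fun y hy => hz y hy i) hγ hS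
  have hq : ∀ (i : Fin n) (c s : ℝ), qf (N i) (c • y0 + s • v)
      = qf (N i) y0 * c ^ 2 + (bf (N i) y0 v + bf (N i) v y0) * (c * s)
        + qf (N i) v * s ^ 2 := by
    intro i c s
    have e : ∀ x z : Coord n, bf (N i) x z = ∑ r, ∑ t, N i r t * (x t * z r) := by
      intro x z
      simp only [bf, lf, lower, Finset.sum_mul]
      exact Finset.sum_congr rfl fun _ _ => Finset.sum_congr rfl fun _ _ => by ring
    simp only [e, qf, Finset.sum_mul, ← Finset.sum_add_distrib, PiLp.add_apply, PiLp.smul_apply,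
      smul_eq_mul]
    exact Finset.sum_congr rfl fun _ _ => Finset.sum_congr rfl fun _ _ => by ring
  refine ⟨∑ i, w i * qf (N i) y0, ∑ i, w i * (bf (N i) y0 v + bf (N i) v y0),
    ∑ i, w i * qf (N i) v, fun θ hθ => ?_⟩
  simp only [hN _ θ hθ, hq, Finset.sum_mul, ← Finset.sum_add_distrib]
  exact Finset.sum_congr rfl fun _ _ => by ring

include hbs

/-- If the third derivatives of the field `α f y + α² h b` vanish, then `f` is linear and `h` is a
polynomial `m + k s²` on the values of `s` on an arc that starts in the direction `y₀` and turns
towards a vector `v` orthogonal to `y₀` and `b`: both components of the field along the arc are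
quadratic in `(cos θ, sin θ)`, and `s` is even in `θ`. -/
theorem eq_on_arc {y0 v : Coord n} (hy0 : qf M y0 = 1) (hv : qf M v = 1)
    (hyv : lf (lower M y0) v = 0) (hbv : lf b v = 0) {x0 : ℝ} (hx0 : -1 ≤ x0) (hx0' : x0 < 1)
    (hmem : ∀ x ∈ Set.Icc x0 1, lf b y0 * x ∈ V) :
    ∃ Y m k : ℝ, ∀ x ∈ Set.Ioo x0 1,
      f (lf b y0 * x) = Y * x ∧ lf b bs * h (lf b y0 * x) = m + k * x ^ 2 := by
  have hs := isSymm_of_posDef hM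
  set q := Real.arccos x0 with hq
  have hqf : ∀ θ, qf M (Real.cos θ • y0 + Real.sin θ • v) = 1 := by
    intro θ
    rw [qf_add hs, qf_smul, qf_smul, bf_smul_left hs, bf_smul_right, bf, hyv, hy0, hv]
    linarith [Real.sin_sq_add_cos_sq θ]
  have hlf : ∀ θ, lf b (Real.cos θ • y0 + Real.sin θ • v) = lf b y0 * Real.cos θ := by
    intro θ
    rw [lf_add, lf_smul, lf_smul, hbv]; ring
  have hcos : ∀ θ ∈ Set.Icc (-q) q, Real.cos θ ∈ Set.Icc x0 1 := by
    intro θ hθ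
    refine ⟨?_, Real.cos_le_one θ⟩
    rw [← Real.cos_arccos hx0 hx0'.le, ← Real.cos_abs θ]
    exact Real.cos_le_cos_of_nonneg_of_le_pi (abs_nonneg θ) (Real.arccos_le_pi x0) (abs_le.2 hθ)
  have hS : ∀ θ ∈ Set.Icc (-q) q, Real.cos θ • y0 + Real.sin θ • v ∈ ratioDomain M b V := by
    intro θ hθ
    refine ⟨fun h0 => ?_, ?_⟩
    · have := hqf θ
      rw [h0] at this
      simp [qf] at this
    · rw [hqf, hlf, Real.sqrt_one, div_one]
      exact hmem _ (hcos θ hθ)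
  have hval : ∀ θ i, abField M b bs f h i (Real.cos θ • y0 + Real.sin θ • v)
      = f (lf b y0 * Real.cos θ) * (Real.cos θ * y0 i + Real.sin θ * v i)
        + h (lf b y0 * Real.cos θ) * bs i := by
    intro θ i
    rw [abField, hqf, hlf, Real.sqrt_one, div_one]
    simp
  have hsum : ∀ (w : Fin n → ℝ) θ,
      ∑ i, w i * abField M b bs f h i (Real.cos θ • y0 + Real.sin θ • v)
        = f (lf b y0 * Real.cos θ) * (Real.cos θ * lf w y0 + Real.sin θ * lf w v)
          + h (lf b y0 * Real.cos θ) * lf w bs := by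
    intro w θ
    simp only [hval, lf, Finset.mul_sum, ← Finset.sum_add_distrib]
    exact Finset.sum_congr rfl fun i _ => by ring
  -- the pairing with `v` isolates `f`, the pairing with `b` gives `f s + h b²`
  obtain ⟨X, Y, Z, h1⟩ := abField_arc hM hV hf hh hz hS (lower M v)
  obtain ⟨X', Y', Z', h2⟩ := abField_arc hM hV hf hh hz hS b
  have e1 : lf (lower M v) y0 = 0 := by
    rw [← hyv]; exact bf_comm hs v y0
  have e2 : lf (lower M v) v = 1 := by
    rw [← hv]; exact bf_self M v
  have e3 : lf (lower M v) bs = 0 := by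
    rw [← hbv, ← bf_dual_left hbs v]; exact bf_comm hs v bs
  simp only [hsum, e1, e2, e3, hbv] at h1 h2
  refine ⟨Y, Z', X' - Z' - lf b y0 * Y, fun x hx => ?_⟩
  set θ := Real.arccos x with hθ
  have hx1 : Real.cos θ = x := Real.cos_arccos (hx0.trans hx.1.le) hx.2.le
  have hθ0 : 0 < θ := Real.arccos_pos.2 hx.2
  have hθq : θ < q := Real.strictAntiOn_arccos ⟨hx0, (hx.1.trans hx.2).le⟩
    ⟨hx0.trans hx.1.le, hx.2.le⟩ hx.1
  have hsin : 0 < Real.sin θ := Real.sin_pos_of_pos_of_lt_pi hθ0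
    (hθq.trans_le (Real.arccos_le_pi x0))
  -- the values at `θ` and at `-θ` are compared, where `s` agrees and `sin` changes its sign
  have hm1 : θ ∈ Set.Icc (-q) q := ⟨by linarith, hθq.le⟩
  have hm2 : -θ ∈ Set.Icc (-q) q := ⟨by linarith, by linarith⟩
  have a1 := h1 θ hm1
  have a2 := h1 (-θ) hm2
  have b1 := h2 θ hm1
  have b2 := h2 (-θ) hm2
  have hsc := Real.sin_sq_add_cos_sq θ
  simp only [Real.cos_neg, Real.sin_neg] at a2 b2
  rw [hx1] at a1 a2 b1 b2 hsc
  have hfx : f (lf b y0 * x) = Y * x := by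
    have : f (lf b y0 * x) * Real.sin θ = Y * x * Real.sin θ := by linear_combination (a1 - a2) / 2
    exact mul_right_cancel₀ hsin.ne' this
  refine ⟨hfx, ?_⟩
  rw [hfx] at b1 b2
  linear_combination (b1 + b2) / 2 + Z' * hsc

/-- On the values of `s` along an arc as in `eq_on_arc`, `f = s f'` and `h' = s h''`; at the end
points by continuity. -/
theorem ode_on_arc {y0 v : Coord n} (hy0 : qf M y0 = 1) (hv : qf M v = 1)
    (hyv : lf (lower M y0) v = 0) (hbv : lf b v = 0) {x0 : ℝ} (hx0 : -1 ≤ x0) (hx0' : x0 < 1)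
    (hmem : ∀ x ∈ Set.Icc x0 1, lf b y0 * x ∈ V) (hσ : lf b y0 ≠ 0) (ht : lf b bs ≠ 0)
    {x : ℝ} (hx : x ∈ Set.Icc x0 1) :
    f (lf b y0 * x) - lf b y0 * x * deriv f (lf b y0 * x) = 0 ∧
      deriv h (lf b y0 * x) - lf b y0 * x * deriv (deriv h) (lf b y0 * x) = 0 := by
  obtain ⟨Y, m, k, H⟩ := eq_on_arc hM hbs hV hf hh hz hy0 hv hyv hbv hx0 hx0' hmem
  set σ := lf b y0
  set t := lf b bs
  have hlin : Continuous fun x : ℝ => σ * x := continuous_const.mul continuous_id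
  have hdf : ContDiffOn ℝ ∞ (deriv f) V := hf.deriv_of_isOpen hV (m := ∞) le_rfl
  have hdh : ContDiffOn ℝ ∞ (deriv h) V := hh.deriv_of_isOpen hV (m := ∞) le_rfl
  have hddh : ContDiffOn ℝ ∞ (deriv (deriv h)) V := hdh.deriv_of_isOpen hV (m := ∞) le_rfl
  have hev : ∀ x ∈ Set.Ioo x0 1, ∀ᶠ s in nhds (σ * x), s / σ ∈ Set.Ioo x0 1 := by
    intro x hx
    have hc : ContinuousAt (fun s => s / σ) (σ * x) := (continuous_id.div_const σ).continuousAt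
    refine hc.eventually (isOpen_Ioo.mem_nhds ?_)
    simpa only [mul_div_cancel_left₀ _ hσ] using hx
  have hf1 : ∀ x ∈ Set.Ioo x0 1, f =ᶠ[nhds (σ * x)] fun s => Y / σ * s := by
    intro x hx
    filter_upwards [hev x hx] with s hs
    have := (H _ hs).1
    rw [mul_div_cancel₀ _ hσ] at this
    rw [this]; ring
  have hh1 : ∀ x ∈ Set.Ioo x0 1, h =ᶠ[nhds (σ * x)] fun s => m / t + k / (t * σ ^ 2) * s ^ 2 := by
    intro x hx
    filter_upwards [hev x hx] with s hs
    have := (H _ hs).2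
    rw [mul_div_cancel₀ _ hσ] at this
    field_simp
    field_simp at this
    linarith
  have hlinD : ∀ p s : ℝ, deriv (fun s => p * s) s = p := fun p s => by
    simp
  have hsqD : ∀ p q : ℝ, deriv (fun s : ℝ => p + q * s ^ 2) = fun s => 2 * q * s := fun p q => by
    funext s
    have := (((hasDerivAt_pow 2 s).const_mul q).const_add p).deriv
    rw [this]; norm_num; ring
  constructor
  · refine Set.EqOn.of_subset_closure (s := Set.Ioo x0 1) (t := Set.Icc x0 1)
      (f := fun x => f (σ * x) - σ * x * deriv f (σ * x)) (g := fun _ => 0) ?_ ?_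
      continuousOn_const Set.Ioo_subset_Icc_self (closure_Ioo hx0'.ne).ge hx
    · intro x hx
      simp only [(hf1 x hx).deriv_eq, (hf1 x hx).eq_of_nhds, hlinD]
      ring
    · exact (hf.continuousOn.comp hlin.continuousOn hmem).sub
        (hlin.continuousOn.mul (hdf.continuousOn.comp hlin.continuousOn hmem))
  · refine Set.EqOn.of_subset_closure (s := Set.Ioo x0 1) (t := Set.Icc x0 1)
      (f := fun x => deriv h (σ * x) - σ * x * deriv (deriv h) (σ * x)) (g := fun _ => 0) ?_ ?_
      continuousOn_const Set.Ioo_subset_Icc_self (closure_Ioo hx0'.ne).ge hx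
    · intro x hx
      have e := (hh1 x hx).deriv
      rw [hsqD] at e
      simp only [e.deriv_eq, e.eq_of_nhds, hlinD]
      ring
    · exact (hdh.continuousOn.comp hlin.continuousOn hmem).sub
        (hlin.continuousOn.mul (hddh.continuousOn.comp hlin.continuousOn hmem))

/-- The equations hold at the value `s ≠ 0` of a unit vector `y₀` that has a common orthogonal
vector with `b`: a short arc from `y₀` suffices. -/
theorem ode_of_orth {y0 v : Coord n} (hy0 : qf M y0 = 1) (hv : qf M v = 1)
    (hyv : lf (lower M y0) v = 0) (hbv : lf b v = 0) (hmem : lf b y0 ∈ V) (hσ : lf b y0 ≠ 0)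
    (ht : lf b bs ≠ 0) :
    f (lf b y0) - lf b y0 * deriv f (lf b y0) = 0 ∧
      deriv h (lf b y0) - lf b y0 * deriv (deriv h) (lf b y0) = 0 := by
  have hc : ContinuousAt (fun x : ℝ => lf b y0 * x) 1 :=
    (continuous_const.mul continuous_id).continuousAt
  have hev := hc.eventually (hV.mem_nhds (by simpa only [mul_one] using hmem))
  obtain ⟨ε, hε, hball⟩ := Metric.eventually_nhds_iff.1 hev
  have := ode_on_arc hM hbs hV hf hh hz hy0 hv hyv hbv (x0 := max (1 - ε / 2) (-1))
    (le_max_right _ _) (max_lt (by linarith) (by norm_num)) (fun x hx => hball (by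
      have h1 := (le_max_left _ _).trans hx.1
      rw [Real.dist_eq, abs_sub_lt_iff]
      constructor <;> linarith [hx.2])) hσ ht (x := 1)
    ⟨max_le (by linarith) (by norm_num), le_rfl⟩
  simpa using this

/-- If `b ≠ 0` and the third derivatives of the field `α f y + α² h b` vanish, then
`f = s f'` and `h' = s h''`. In dimension two the vectors `y` and `b` span the tangent space, and
the arcs have to start at `± b`. -/
theorem ode_of_dyyy_eq_zero (hn : 2 ≤ n) (ht : 0 < lf b bs)
    (hV2 : n = 2 → ∀ s ∈ V, s ^ 2 ≤ lf b bs →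
      (∀ r ∈ Set.Icc s (√(lf b bs)), r ∈ V) ∨ (∀ r ∈ Set.Icc (-√(lf b bs)) s, r ∈ V))
    {s : ℝ} (hs : s ∈ V) (hsb : s ^ 2 ≤ lf b bs) :
    f s - s * deriv f s = 0 ∧ deriv h s - s * deriv (deriv h) s = 0 := by
  have hsym := isSymm_of_posDef hM
  set t := lf b bs with ht_def
  have hqb : qf M bs = t := by rw [← bf_self, bf_dual_left hbs]
  obtain ⟨v1, hv1, hbv1⟩ := exists_unit_orth hM (m := 1) (by omega) (fun _ => b)
  replace hbv1 := hbv1 0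
  have hy1 : ∀ r : ℝ, r ^ 2 = t → qf M ((r / t) • bs) = 1 ∧ lf b ((r / t) • bs) = r
      ∧ lf (lower M ((r / t) • bs)) v1 = 0 := by
    intro r hr
    refine ⟨?_, ?_, ?_⟩
    · rw [qf_smul, hqb, div_pow, hr]; field_simp
    · rw [lf_smul, ← ht_def]; field_simp
    · have : lf (lower M ((r / t) • bs)) v1 = bf M ((r / t) • bs) v1 := rfl
      rw [this, bf_smul_left hsym, bf_dual_left hbs, hbv1, mul_zero]
  rcases hsb.eq_or_lt with hst | hst
  · obtain ⟨q1, q2, q3⟩ := hy1 s hst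
    have hs0 : s ≠ 0 := by rintro rfl; simp at hst; exact ht.ne hst
    have := ode_of_orth hM hbs hV hf hh hz q1 hv1 q3 hbv1 (by rwa [q2]) (by rwa [q2]) ht.ne'
    rwa [q2] at this
  have hrt : √t ^ 2 = t := Real.sq_sqrt ht.le
  have hr0 : 0 < √t := Real.sqrt_pos.2 ht
  have habs := abs_lt.1 (Real.lt_sqrt (abs_nonneg s) |>.2 (by rwa [sq_abs]))
  rcases hn.eq_or_lt with hn2 | hn3
  -- for `n = 2`, arcs from `b / ‖b‖` or `-b / ‖b‖` to a vector with the given `s`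
  · rcases hV2 hn2.symm s hs hsb with hI | hI
    · obtain ⟨q1, q2, q3⟩ := hy1 (√t) hrt
      have := ode_on_arc hM hbs hV hf hh hz q1 hv1 q3 hbv1 (x0 := s / √t)
        (by rw [le_div_iff₀ hr0]; linarith) (by rw [div_lt_one hr0]; exact habs.2)
        (fun x hx => by
          rw [q2]
          refine hI _ ⟨?_, by nlinarith [hx.2]⟩
          have := (div_le_iff₀ hr0).1 hx.1
          linarith) (by rw [q2]; exact hr0.ne') ht.ne' (x := s / √t)
        ⟨le_rfl, ((div_lt_one hr0).2 habs.2).le⟩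
      rwa [q2, mul_div_cancel₀ _ hr0.ne'] at this
    · obtain ⟨q1, q2, q3⟩ := hy1 (-√t) (by rw [neg_sq, hrt])
      have h1 : -s / √t < 1 := by rw [div_lt_one hr0]; linarith [habs.1]
      have := ode_on_arc hM hbs hV hf hh hz q1 hv1 q3 hbv1 (x0 := -s / √t)
        (by rw [le_div_iff₀ hr0]; linarith) h1
        (fun x hx => by
          rw [q2]
          refine hI _ ⟨by nlinarith [hx.2], ?_⟩
          have := (div_le_iff₀ hr0).1 hx.1
          linarith) (by rw [q2]; exact (neg_lt_zero.2 hr0).ne) ht.ne' (x := -s / √t)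
        ⟨le_rfl, h1.le⟩
      have e : -√t * (-s / √t) = s := by field_simp
      rwa [q2, e] at this
  · have hne : ∀ r ∈ V, r ^ 2 < t → r ≠ 0 →
        f r - r * deriv f r = 0 ∧ deriv h r - r * deriv (deriv h) r = 0 := by
      intro r hr hrt hr0
      obtain ⟨y0, q1, q2⟩ := exists_unit_lf_eq hM hbs hn hrt.le
      obtain ⟨v, hv, hvo⟩ := exists_unit_orth hM (m := 2) hn3 ![b, lower M y0]
      have := ode_of_orth hM hbs hV hf hh hz q1 hv (hvo 1) (hvo 0) (by rwa [q2]) (by rwa [q2])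
        ht.ne'
      rwa [q2] at this
    rcases eq_or_ne s 0 with rfl | hs0
    -- `s` is constant along arcs from vectors orthogonal to `b`, so `s = 0` is treated as a limit
    · have hdf : ContDiffOn ℝ ∞ (deriv f) V := hf.deriv_of_isOpen hV (m := ∞) le_rfl
      have hdh : ContDiffOn ℝ ∞ (deriv h) V := hh.deriv_of_isOpen hV (m := ∞) le_rfl
      have hddh : ContDiffOn ℝ ∞ (deriv (deriv h)) V := hdh.deriv_of_isOpen hV (m := ∞) le_rfl
      have hev : ∀ᶠ r in nhdsWithin (0 : ℝ) (Set.Ioi 0), f r - r * deriv f r = 0 ∧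
          deriv h r - r * deriv (deriv h) r = 0 := by
        have h1 : ∀ᶠ r in nhds (0 : ℝ), r ^ 2 < t :=
          (continuous_pow 2).continuousAt.eventually (gt_mem_nhds (by simpa using ht))
        filter_upwards [mem_nhdsWithin_of_mem_nhds (hV.mem_nhds hs),
          mem_nhdsWithin_of_mem_nhds h1, self_mem_nhdsWithin] with r p1 p2 p3
        exact hne r p1 p2 (ne_of_gt p3)
      have hN := hV.mem_nhds hs
      have c1 : ContinuousAt (fun r => f r - r * deriv f r) 0 :=
        (hf.continuousOn.continuousAt hN).sub
          (continuousAt_id.mul (hdf.continuousOn.continuousAt hN))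
      have c2 : ContinuousAt (fun r => deriv h r - r * deriv (deriv h) r) 0 :=
        (hdh.continuousOn.continuousAt hN).sub
          (continuousAt_id.mul (hddh.continuousOn.continuousAt hN))
      exact ⟨tendsto_nhds_unique (c1.tendsto.mono_left nhdsWithin_le_nhds)
          (tendsto_const_nhds.congr' (hev.mono fun r hr => hr.1.symm)),
        tendsto_nhds_unique (c2.tendsto.mono_left nhdsWithin_le_nhds)
          (tendsto_const_nhds.congr' (hev.mono fun r hr => hr.2.symm))⟩
    · exact hne s hs hst hs0

/-- If `b = 0`, the field is `α f(0) y`, whose third derivatives vanish only for `f(0) = 0`. -/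
theorem eq_zero_of_dyyy_eq_zero (hn : 2 ≤ n) (ht : lf b bs = 0) (h0 : (0 : ℝ) ∈ V) : f 0 = 0 := by
  have hlf : ∀ y, lf b y = 0 := fun y => by
    have := sq_lf_le hM hbs y
    rw [ht, zero_mul] at this
    exact pow_eq_zero_iff two_ne_zero |>.1 (le_antisymm this (sq_nonneg _))
  obtain ⟨y0, hy0, -⟩ := exists_unit_orth hM (m := 1) (by omega) (fun _ => b)
  obtain ⟨v, hv, hvo⟩ := exists_unit_orth hM (m := 1) (by omega) (fun _ => lower M y0)
  obtain ⟨Y, _, _, H⟩ := eq_on_arc hM hbs hV hf hh hz hy0 hv (hvo 0) (hlf v) (x0 := -1) le_rfl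
    (by norm_num) (fun x _ => by rwa [hlf, zero_mul])
  simpa using (H 0 (by norm_num)).1

end

end

/-! ### The functions `E` and `H` for fixed `b²` -/

theorem contDiffOn_slice {f : ℝ → ℝ → ℝ} {W : Set (ℝ × ℝ)}
    (hf : ContDiffOn ℝ ∞ (Function.uncurry f) W) (t : ℝ) :
    ContDiffOn ℝ ∞ (f t) {s | (t, s) ∈ W} :=
  hf.comp (contDiffOn_const.prodMk contDiffOn_id) fun _ hs => hs

theorem isOpen_slice {W : Set (ℝ × ℝ)} (hW : IsOpen W) (t : ℝ) : IsOpen {s | (t, s) ∈ W} :=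
  hW.preimage (continuous_const.prodMk continuous_id)

/-- The points of `U` at which the formulas for `Efun φ` and `Hfun φ` have nonzero denominators. -/
def regularSet (φ : ℝ → ℝ → ℝ) (U : Set (ℝ × ℝ)) : Set (ℝ × ℝ) :=
  {p ∈ U | φ p.1 p.2 * (φ p.1 p.2 - p.2 * D2 φ p.1 p.2
    + (p.1 - p.2 ^ 2) * D2 (D2 φ) p.1 p.2) ≠ 0}

section
variable {φ : ℝ → ℝ → ℝ} {U : Set (ℝ × ℝ)} (hU : IsOpen U)
  (hφ : ContDiffOn ℝ ∞ (Function.uncurry φ) U)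
include hU hφ

theorem contDiffOn_denom : ContDiffOn ℝ ∞ (fun p : ℝ × ℝ => φ p.1 p.2 - p.2 * D2 φ p.1 p.2
    + (p.1 - p.2 ^ 2) * D2 (D2 φ) p.1 p.2) U := by
  have h2 := contDiffOn_D2 hU hφ
  have h22 := contDiffOn_D2 hU h2
  exact (hφ.sub (contDiffOn_snd.mul h2)).add
    ((contDiffOn_fst.sub (contDiffOn_snd.pow 2)).mul h22)

theorem isOpen_regularSet : IsOpen (regularSet φ U) :=
  (hφ.mul (contDiffOn_denom hU hφ)).continuousOn.isOpen_inter_preimage hU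
    (isOpen_compl_singleton (x := (0 : ℝ)))

theorem contDiffOn_Hfun :
    ContDiffOn ℝ ∞ (Function.uncurry (Hfun φ)) (regularSet φ U) := by
  have h1 := contDiffOn_D1 hU hφ
  have h2 := contDiffOn_D2 hU hφ
  have h22 := contDiffOn_D2 hU h2
  have h12 := contDiffOn_D2 hU h1
  have hs : regularSet φ U ⊆ U := fun p hp => hp.1
  refine ((h22.sub (contDiffOn_const.mul (h1.sub (contDiffOn_snd.mul h12)))).mono hs).div
    ((contDiffOn_const.mul (contDiffOn_denom hU hφ)).mono hs)
    fun p hp => mul_ne_zero two_ne_zero (right_ne_zero_of_mul hp.2)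

theorem contDiffOn_Efun :
    ContDiffOn ℝ ∞ (Function.uncurry (Efun φ)) (regularSet φ U) := by
  have h1 := contDiffOn_D1 hU hφ
  have h2 := contDiffOn_D2 hU hφ
  have hs : regularSet φ U ⊆ U := fun p hp => hp.1
  have hφ0 : ∀ p ∈ regularSet φ U, Function.uncurry φ p ≠ 0 :=
    fun p hp => left_ne_zero_of_mul hp.2
  refine (((h2.add ((contDiffOn_const.mul contDiffOn_snd).mul h1)).mono hs).div
    ((contDiffOn_const.mul hφ).mono hs) fun p hp => mul_ne_zero two_ne_zero (hφ0 p hp)).sub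
    ((contDiffOn_Hfun hU hφ).mul (((((contDiffOn_snd.mul hφ).add
      ((contDiffOn_fst.sub (contDiffOn_snd.pow 2)).mul h2)).mono hs)).div (hφ.mono hs) hφ0))

/-- The derivative in `s` of `E - r φ`, the coefficient of `α y` in the defect of isotropy. -/
theorem deriv_factor {t r s : ℝ} (hs : (t, s) ∈ regularSet φ U) :
    deriv (fun s => Efun φ t s - r * φ t s) s = D2 (Efun φ) t s - r * D2 φ t s := by
  have hV := (isOpen_slice (isOpen_regularSet hU hφ) t).mem_nhds hs
  have h1 := ((contDiffOn_slice (contDiffOn_Efun hU hφ) t).differentiableOn (by simp)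
    ).differentiableAt hV
  have h2 := ((contDiffOn_slice (hφ.mono fun _ hp => hp.1 : ContDiffOn ℝ ∞ _ (regularSet φ U))
    t).differentiableOn (by simp)).differentiableAt hV
  exact (h1.hasDerivAt.sub (h2.hasDerivAt.const_mul r)).deriv

end

/-! ### The metric and the 1-form in a chart -/

section
variable {n : ℕ} {M : Type*} [TopologicalSpace M] [ChartedSpace (Coord n) M]
  [IsManifold (𝓡 n) ∞ M] {e : OpenPartialHomeomorph M (Coord n)}
  (he : e ∈ IsManifold.maximalAtlas (𝓡 n) ∞ M) {u : Coord n} (hu : u ∈ e.target)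

omit [IsManifold (𝓡 n) ∞ M] in
include he in
theorem mdifferentiable_of_mem_maximalAtlas : e.MDifferentiable (𝓡 n) 𝓘(ℝ, Coord n) := by
  have h1 : e ∈ IsManifold.maximalAtlas (𝓡 n) 1 M :=
    IsManifold.maximalAtlas_subset_of_le (by simp) he
  exact ⟨fun x hx => (mdifferentiableAt_of_mem_maximalAtlas h1 hx).mdifferentiableWithinAt,
    fun x hx => (mdifferentiableAt_symm_of_mem_maximalAtlas h1 hx).mdifferentiableWithinAt⟩

variable (e u) in
/-- The coordinate isomorphism from `ℝⁿ` to the tangent space at `e.symm u`, as a linear map. -/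
def chartMap : Coord n →L[ℝ] TangentSpace (𝓡 n) (e.symm u) :=
  mfderiv 𝓘(ℝ, Coord n) (𝓡 n) e.symm u

omit [IsManifold (𝓡 n) ∞ M] in
theorem chartVec_eq (y : Coord n) : chartVec e u y = ⟨e.symm u, chartMap e u y⟩ := rfl

omit [IsManifold (𝓡 n) ∞ M] in
include he hu in
theorem chartMap_bijective : Function.Bijective (chartMap e u) :=
  (mdifferentiable_of_mem_maximalAtlas he).symm.mfderiv_bijective hu

theorem lf_formCoeff (β : OneForm n M) (e : OpenPartialHomeomorph M (Coord n)) (u y : Coord n) :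
    lf (formCoeff β e u) y = β.form (e.symm u) (chartMap e u y) := by
  conv_rhs => rw [sum_smul_single y, map_sum, map_sum]
  refine Finset.sum_congr rfl fun i _ => ?_
  rw [map_smul, map_smul, smul_eq_mul, mul_comm]
  rfl

theorem qf_metricCoeff (a : RiemMetric n M) (e : OpenPartialHomeomorph M (Coord n))
    (u y : Coord n) :
    qf (metricCoeff a e u) y = a.inner (e.symm u) (chartMap e u y) (chartMap e u y) := by
  have h : ∀ v : TangentSpace (𝓡 n) (e.symm u), a.inner (e.symm u) v (chartMap e u y)
      = ∑ j, y j * a.inner (e.symm u) v (chartMap e u (EuclideanSpace.single j 1)) := by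
    intro v
    conv_lhs => rw [sum_smul_single y, map_sum, map_sum]
    exact Finset.sum_congr rfl fun i _ => by rw [map_smul, map_smul, smul_eq_mul]
  rw [h]
  have h2 : ∀ j, a.inner (e.symm u) (chartMap e u y) (chartMap e u (EuclideanSpace.single j 1))
      = ∑ i, y i * metricCoeff a e u i j := by
    intro j
    rw [a.symm, h]
    exact Finset.sum_congr rfl fun i _ => by rw [a.symm]; rfl
  simp only [h2, qf, Finset.mul_sum]
  rw [Finset.sum_comm]
  exact Finset.sum_congr rfl fun i _ => Finset.sum_congr rfl fun j _ => by ring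

theorem metricCoeff_isSymm (a : RiemMetric n M) (e : OpenPartialHomeomorph M (Coord n))
    (u : Coord n) : (metricCoeff a e u).IsSymm := by
  ext i j
  exact a.symm _ _ _

include he hu in
theorem metricCoeff_posDef (a : RiemMetric n M) : (metricCoeff a e u).PosDef := by
  refine .of_dotProduct_mulVec_pos ?_ fun x hx => ?_
  · have := metricCoeff_isSymm a e u
    simpa [Matrix.IsHermitian, Matrix.IsSymm] using this
  · have h := qf_eq_dotProduct (metricCoeff a e u) (WithLp.toLp 2 x)
    rw [qf_metricCoeff] at h
    simp only [star_trivial]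
    rw [← h]
    refine a.pos _ _ fun h0 => hx ?_
    have := (chartMap_bijective he hu).1 (h0.trans (map_zero _).symm)
    simpa using congrArg WithLp.ofLp this

theorem alpha_chartVec (a : RiemMetric n M) (y : Coord n) :
    alpha a (chartVec e u y) = √(qf (metricCoeff a e u) y) := by
  rw [qf_metricCoeff]; rfl

theorem sVar_chartVec (a : RiemMetric n M) (β : OneForm n M) (y : Coord n) :
    sVar a β (chartVec e u y)
      = lf (formCoeff β e u) y / √(qf (metricCoeff a e u) y) := by
  rw [← alpha_chartVec, lf_formCoeff]; rfl

theorem normForm_nonneg (a : RiemMetric n M) (β : OneForm n M) (x : M) : 0 ≤ normForm a β x := by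
  refine Real.sSup_nonneg ?_
  rintro _ ⟨v, -, rfl⟩
  exact abs_nonneg _

include he hu in
/-- `‖β‖² = a^{ij} b_i b_j`. -/
theorem normForm_sq (a : RiemMetric n M) (β : OneForm n M) : normForm a β (e.symm u) ^ 2
    = lf (formCoeff β e u) (raise (metricCoeff a e u) (formCoeff β e u)) := by
  have hM := metricCoeff_posDef he hu a
  set N := metricCoeff a e u
  set b := formCoeff β e u
  set bs := raise N b
  have hbs : ∀ i, lower N bs i = b i := lower_raise hM.det_pos.ne'.isUnit b
  have hqb : qf N bs = lf b bs := by rw [← bf_self, bf_dual_left hbs]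
  have ht : 0 ≤ lf b bs := hqb ▸ qf_nonneg hM bs
  have key : IsGreatest {t : ℝ | ∃ v : TangentSpace (𝓡 n) (e.symm u),
      alpha a ⟨e.symm u, v⟩ ≤ 1 ∧ t = |β.form (e.symm u) v|} (√(lf b bs)) := by
    constructor
    · rcases ht.eq_or_lt with h0 | h0
      · refine ⟨0, ?_, ?_⟩
        · simp [alpha]
        · rw [← h0]; simp
      · refine ⟨chartMap e u ((√(lf b bs))⁻¹ • bs), ?_, ?_⟩
        · rw [← chartVec_eq, alpha_chartVec, qf_smul, hqb, inv_pow, Real.sq_sqrt ht,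
            inv_mul_cancel₀ h0.ne', Real.sqrt_one]
        · rw [← lf_formCoeff, lf_smul, abs_of_nonneg (by positivity)]
          have := Real.mul_self_sqrt ht
          have h1 : √(lf b bs) ≠ 0 := (Real.sqrt_pos.2 h0).ne'
          field_simp
          linarith
    · rintro _ ⟨v, hv, rfl⟩
      obtain ⟨y, rfl⟩ := (chartMap_bijective he hu).2 v
      rw [← chartVec_eq, alpha_chartVec] at hv
      have hq : qf N y ≤ 1 := by
        have := Real.sqrt_le_one.1 hv
        exact this
      rw [← lf_formCoeff]
      refine Real.abs_le_sqrt ((sq_lf_le hM hbs y).trans ?_)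
      nlinarith
  rw [normForm, key.csSup_eq, Real.sq_sqrt ht]

include he hu

theorem contMDiffAt_chartVec (y : Coord n) : ContMDiffAt 𝓘(ℝ, Coord n) (𝓡 n).tangent 1
    (fun w => chartVec e w y) u := by
  have h1 : ContMDiffAt 𝓘(ℝ, Coord n) (𝓡 n) ∞ e.symm u :=
    contMDiffAt_symm_of_mem_maximalAtlas he hu
  have h2 := h1.mfderiv_const (m := 1) (by exact WithTop.coe_le_coe.2 le_top)
  have h3 : ContMDiffAt 𝓘(ℝ, Coord n) 𝓘(ℝ, Coord n).tangent 1
      (fun w : Coord n => (⟨w, y⟩ : TangentBundle 𝓘(ℝ, Coord n) (Coord n))) u :=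
    (contMDiffAt_vectorSpace_iff_contDiffAt (V := fun _ => y)).2 contDiffAt_const
  exact ContMDiffAt.clm_apply_of_inCoordinates h2 h3 (h1.of_le (by simp))

theorem differentiableAt_metricCoeff (a : RiemMetric n M) (i j : Fin n) :
    DifferentiableAt ℝ (fun w => metricCoeff a e w i j) u := by
  have h1 : ContMDiffAt 𝓘(ℝ, Coord n) (𝓡 n) 1 e.symm u :=
    (contMDiffAt_symm_of_mem_maximalAtlas he hu).of_le (by simp)
  have : ContMDiffAt 𝓘(ℝ, Coord n) ((𝓡 n).prod 𝓘(ℝ)) 1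
      (fun w => Bundle.TotalSpace.mk' ℝ (E := Bundle.Trivial M ℝ) (e.symm w)
        (metricCoeff a e w i j)) u := by
    refine ContMDiffAt.clm_bundle_apply₂ (𝕜 := ℝ) (F₁ := Coord n) (F₂ := Coord n)
      (E₃ := Bundle.Trivial M ℝ)
      (ψ := fun w => a.inner (e.symm w)) (b := fun w => e.symm w)
      (v := fun w => (chartVec e w (EuclideanSpace.single i 1)).2)
      (w := fun w => (chartVec e w (EuclideanSpace.single j 1)).2) ?_ ?_ ?_
    · exact ((a.contMDiff.of_le (by simp)).contMDiffAt).comp u h1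
    · exact contMDiffAt_chartVec he hu _
    · exact contMDiffAt_chartVec he hu _
  simp only [Bundle.contMDiffAt_totalSpace] at this
  exact (contMDiffAt_iff_contDiffAt.1 this.2).differentiableAt (by simp)

theorem differentiableAt_formCoeff (β : OneForm n M) (i : Fin n) :
    DifferentiableAt ℝ (fun w => formCoeff β e w i) u := by
  have h1 : ContMDiffAt 𝓘(ℝ, Coord n) (𝓡 n) 1 e.symm u :=
    (contMDiffAt_symm_of_mem_maximalAtlas he hu).of_le (by simp)
  have : ContMDiffAt 𝓘(ℝ, Coord n) ((𝓡 n).prod 𝓘(ℝ)) 1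
      (fun w => Bundle.TotalSpace.mk' ℝ (E := Bundle.Trivial M ℝ) (e.symm w)
        (formCoeff β e w i)) u := by
    refine ContMDiffAt.clm_bundle_apply (𝕜 := ℝ) (F₁ := Coord n) (E₂ := Bundle.Trivial M ℝ)
      (ϕ := fun w => β.form (e.symm w)) (b := fun w => e.symm w)
      (v := fun w => (chartVec e w (EuclideanSpace.single i 1)).2) ?_ ?_
    · exact ((β.contMDiff.of_le (by simp)).contMDiffAt).comp u h1
    · exact contMDiffAt_chartVec he hu _
  simp only [Bundle.contMDiffAt_totalSpace] at this
  exact (contMDiffAt_iff_contDiffAt.1 this.2).differentiableAt (by simp)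

end

/-! ### The metric `α φ(b², s)` in a chart -/

section
variable {n : ℕ} {M : Type*} [TopologicalSpace M] [ChartedSpace (Coord n) M]
  [IsManifold (𝓡 n) ∞ M]

variable (a : RiemMetric n M) (β : OneForm n M) {U : Set (ℝ × ℝ)} (hU : IsOpen U)
  {φ : ℝ → ℝ → ℝ} (hφ : ContDiffOn ℝ ∞ (Function.uncurry φ) U)
  {e : OpenPartialHomeomorph M (Coord n)} {u : Coord n}

theorem inChart_generalAB (w y : Coord n) : inChart e (generalAB a β φ) w y
    = √(qf (metricCoeff a e w) y) * φ (normForm a β (e.symm w) ^ 2)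
      (lf (formCoeff β e w) y / √(qf (metricCoeff a e w) y)) := by
  rw [inChart, generalAB, alpha_chartVec, sVar_chartVec]
  rfl

theorem sq_inChart_generalAB (w y : Coord n) (h : 0 < qf (metricCoeff a e w) y) :
    inChart e (generalAB a β φ) w y ^ 2 = lag φ (lagArg (metricCoeff a e) (formCoeff β e)
      (fun w => normForm a β (e.symm w) ^ 2) w y) := by
  rw [inChart_generalAB, mul_pow, Real.sq_sqrt h.le]
  rfl

variable (he : e ∈ IsManifold.maximalAtlas (𝓡 n) ∞ M) (hu : u ∈ e.target)
include he hu

theorem chartVec_mem_domainAB_iff (y : Coord n) : chartVec e u y ∈ domainAB a β U ↔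
    y ≠ 0 ∧ (normForm a β (e.symm u) ^ 2,
      lf (formCoeff β e u) y / √(qf (metricCoeff a e u) y)) ∈ U := by
  rw [domainAB, Set.mem_ofPred_eq, sVar_chartVec]
  refine and_congr (not_congr ?_) Iff.rfl
  exact map_eq_zero_iff (chartMap e u) (chartMap_bijective he hu).1

theorem lower_raise_metricCoeff (i : Fin n) : lower (metricCoeff a e u)
    (raise (metricCoeff a e u) (formCoeff β e u)) i = formCoeff β e u i :=
  lower_raise (metricCoeff_posDef he hu a).det_pos.ne'.isUnit _ i

variable (hn : 2 ≤ n) (hF : IsFinslerOn (domainAB a β U) (generalAB a β φ))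
include hU hφ hn hF

/-- A Finsler metric has `φ > 0`, and `E` and `H` have nonzero denominators, on its domain. -/
theorem pos_and_mem_regularSet {y : Coord n} (hy : chartVec e u y ∈ domainAB a β U) :
    0 < φ (normForm a β (e.symm u) ^ 2)
        (lf (formCoeff β e u) y / √(qf (metricCoeff a e u) y)) ∧
      (normForm a β (e.symm u) ^ 2,
        lf (formCoeff β e u) y / √(qf (metricCoeff a e u) y)) ∈ regularSet φ U := by
  have hM := metricCoeff_posDef he hu a
  obtain ⟨hy0, hyU⟩ := (chartVec_mem_domainAB_iff a β he hu y).1 hy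
  have hpos := hF.pos _ hy
  have e1 : generalAB a β φ (chartVec e u y) = inChart e (generalAB a β φ) u y := rfl
  rw [e1, inChart_generalAB] at hpos
  have h1 := pos_of_mul_pos_right hpos (Real.sqrt_nonneg _)
  have h2 := denom_pos (a := metricCoeff a e) (b := formCoeff β e)
    (t := fun w => normForm a β (e.symm w) ^ 2) hU hφ hn hM
    (lower_raise_metricCoeff a β he hu) (normForm_sq he hu a β).symm hy0 hyU
    (sq_inChart_generalAB a β u) (hF.posDef e he u hu y hy) rfl h1
  exact ⟨h1, hyU, mul_ne_zero h1.ne' h2.ne'⟩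

/-- The points in question in the two equations are values of `(b², β / α)` on the domain of `F`,
since each `s` with `|s| ≤ b` is the value of `β` on a unit vector. -/
theorem mem_regularSet_of_abs_le {s : ℝ} (hs : |s| ≤ normForm a β (e.symm u))
    (hsU : (normForm a β (e.symm u) ^ 2, s) ∈ U) :
    (normForm a β (e.symm u) ^ 2, s) ∈ regularSet φ U := by
  have hM := metricCoeff_posDef he hu a
  have h1 : s ^ 2 ≤ normForm a β (e.symm u) ^ 2 := sq_le_sq' (abs_le.1 hs).1 (abs_le.1 hs).2
  rw [normForm_sq he hu] at h1
  obtain ⟨y, hy1, hy2⟩ := exists_unit_lf_eq hM (lower_raise_metricCoeff a β he hu) hn h1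
  have h2 : lf (formCoeff β e u) y / √(qf (metricCoeff a e u) y) = s := by
    rw [hy1, hy2, Real.sqrt_one, div_one]
  have h3 : chartVec e u y ∈ domainAB a β U := by
    rw [chartVec_mem_domainAB_iff a β he hu, h2]
    exact ⟨fun h => by rw [h] at hy1; simp [qf] at hy1, hsU⟩
  have := (pos_and_mem_regularSet a β hU hφ he hu hn hF h3).2
  rwa [h2] at this

theorem chartVec_mem_iff_mem_ratioDomain (y : Coord n) : chartVec e u y ∈ domainAB a β U ↔
    y ∈ ratioDomain (metricCoeff a e u) (formCoeff β e u)
      {s | (normForm a β (e.symm u) ^ 2, s) ∈ regularSet φ U} :=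
  ⟨fun h => ⟨((chartVec_mem_domainAB_iff a β he hu y).1 h).1,
      (pos_and_mem_regularSet a β hU hφ he hu hn hF h).2⟩,
    fun h => (chartVec_mem_domainAB_iff a β he hu y).2 ⟨h.1, h.2.1⟩⟩

variable {c : M → ℝ} (hc : ∀ x, c x ≠ 0)
  (hβ : ∀ e ∈ IsManifold.maximalAtlas (𝓡 n) ∞ M, ∀ u ∈ e.target, ∀ i j : Fin n,
    covDeriv a β e u i j = c (e.symm u) * metricCoeff a e u i j)
include hβ

theorem spray_generalAB {y : Coord n} (hy : chartVec e u y ∈ domainAB a β U) (i : Fin n) :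
    spray (inChart e (generalAB a β φ)) i u y
      = (1 / 2) * chrSpray (metricCoeff a e) u y i
        + c (e.symm u) * abField (metricCoeff a e u) (formCoeff β e u)
          (raise (metricCoeff a e u) (formCoeff β e u))
          (Efun φ (normForm a β (e.symm u) ^ 2)) (Hfun φ (normForm a β (e.symm u) ^ 2)) i y := by
  have hM := metricCoeff_posDef he hu a
  obtain ⟨hy0, hyU⟩ := (chartVec_mem_domainAB_iff a β he hu y).1 hy
  have hdet := hM.det_pos.ne'.isUnit
  have haD := differentiableAt_metricCoeff he hu a
  have hbD := differentiableAt_formCoeff he hu β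
  have hev : (fun w => normForm a β (e.symm w) ^ 2) =ᶠ[nhds u]
      fun w => lf (formCoeff β e w) (raise (metricCoeff a e w) (formCoeff β e w)) := by
    filter_upwards [e.open_target.mem_nhds hu] with w hw using normForm_sq he hw a β
  have hcov : ∀ i j, db (formCoeff β e) u j i
      - ∑ k, chr (metricCoeff a e) u k i j * formCoeff β e u k
      = c (e.symm u) * metricCoeff a e u i j := hβ e he u hu
  exact spray_eq (a := metricCoeff a e) (b := formCoeff β e)
    (t := fun w => normForm a β (e.symm w) ^ 2) hU hφ hn hM
    (lower_raise_metricCoeff a β he hu) (normForm_sq he hu a β).symm hy0 hyU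
    (sq_inChart_generalAB a β u) (hF.posDef e he u hu y hy) rfl
    (pos_and_mem_regularSet a β hU hφ he hu hn hF hy).1 haD hbD (metricCoeff_isSymm a e)
    ((differentiableAt_normSq haD hbD hdet).congr_of_eventuallyEq hev)
    (.of_forall fun w y => sq_inChart_generalAB a β w y) hcov
    (fun k => by
      rw [hev.fderiv_eq]
      exact fderiv_normSq haD hbD hdet (metricCoeff_isSymm a e) hcov k) i

include hc

/-- The defect of isotropic Berwald curvature with factor `τ` is the third derivative of the
field `α (E - (τ / c) φ) y + α² H b`, up to the factor `c`. -/
theorem berwald_sub_isotropicTensor (τ : ℝ) {y : Coord n}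
    (hy : chartVec e u y ∈ domainAB a β U) (j i k l : Fin n) :
    berwald (inChart e (generalAB a β φ)) j i k l u y
        - τ * isotropicTensor (inChart e (generalAB a β φ)) j i k l u y
      = c (e.symm u) * dyyy j k l (abField (metricCoeff a e u) (formCoeff β e u)
          (raise (metricCoeff a e u) (formCoeff β e u))
          (fun s => Efun φ (normForm a β (e.symm u) ^ 2) s
            - τ / c (e.symm u) * φ (normForm a β (e.symm u) ^ 2) s)
          (Hfun φ (normForm a β (e.symm u) ^ 2)) i) y := by
  have hM := metricCoeff_posDef he hu a
  set t := normForm a β (e.symm u) ^ 2 with ht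
  set V := {s | (t, s) ∈ regularSet φ U} with hV_def
  set S := ratioDomain (metricCoeff a e u) (formCoeff β e u) V with hS_def
  have hV : IsOpen V := isOpen_slice (isOpen_regularSet hU hφ) t
  have hS : IsOpen S := isOpen_ratioDomain hM hV
  have hyS : y ∈ S := (chartVec_mem_iff_mem_ratioDomain a β hU hφ he hu hn hF y).1 hy
  have hφV : ContDiffOn ℝ ∞ (φ t) V :=
    contDiffOn_slice (hφ.mono fun _ hp => hp.1) t
  have hEV : ContDiffOn ℝ ∞ (Efun φ t) V := contDiffOn_slice (contDiffOn_Efun hU hφ) t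
  have hHV : ContDiffOn ℝ ∞ (Hfun φ t) V := contDiffOn_slice (contDiffOn_Hfun hU hφ) t
  have hFS : ContDiffOn ℝ ∞ (inChart e (generalAB a β φ) u) S :=
    (contDiffOn_sqrt_mul_comp_ratio hM hφV).congr fun y _ => inChart_generalAB a β u y
  have hc0 := hc (e.symm u)
  set f := fun s => Efun φ t s - τ / c (e.symm u) * φ t s with hf
  have hfV : ContDiffOn ℝ ∞ f V := hEV.sub (contDiffOn_const.mul hφV)
  have hZ := contDiffOn_abField hM (b := formCoeff β e u)
    (bs := raise (metricCoeff a e u) (formCoeff β e u)) hfV hHV i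
  set Z := abField (metricCoeff a e u) (formCoeff β e u)
    (raise (metricCoeff a e u) (formCoeff β e u)) f (Hfun φ t) i with hZ_def
  set Γ : Matrix (Fin n) (Fin n) ℝ := Matrix.of fun p q => chr (metricCoeff a e) u i p q
  have hspray : Set.EqOn (spray (inChart e (generalAB a β φ)) i u)
      (fun y => (1 / 2) * qf Γ y + (τ * (inChart e (generalAB a β φ) u y * y i)
        + c (e.symm u) * Z y)) S := by
    intro x hx
    have hx' := (chartVec_mem_iff_mem_ratioDomain a β hU hφ he hu hn hF x).2 hx
    rw [spray_generalAB a β hU hφ he hu hn hF hβ hx' i]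
    simp only [hZ_def, abField, hf, inChart_generalAB, chrSpray, ← ht]
    field_simp
    ring
  have h1 : ContDiffOn ℝ ∞ (fun y : Coord n => inChart e (generalAB a β φ) u y * y i) S :=
    hFS.mul (EuclideanSpace.proj i : Coord n →L[ℝ] ℝ).contDiff.contDiffOn
  have h2 : ContDiffOn ℝ ∞ (fun y : Coord n =>
      τ * (inChart e (generalAB a β φ) u y * y i)) S := contDiffOn_const.mul h1
  have h3 : ContDiffOn ℝ ∞ (fun y : Coord n => c (e.symm u) * Z y) S := contDiffOn_const.mul hZ
  have h4 : ContDiffOn ℝ ∞ (qf Γ) S := (contDiff_qf Γ).contDiffOn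
  have h5 : ContDiffOn ℝ ∞ (fun y => (1 / 2 : ℝ) * qf Γ y) S := contDiffOn_const.mul h4
  -- the third derivatives of the quadratic part vanish, those of `F yⁱ` are the isotropic tensor
  have e1 : berwald (inChart e (generalAB a β φ)) j i k l u y
      = dyyy j k l (spray (inChart e (generalAB a β φ)) i u) y := rfl
  have e2 : isotropicTensor (inChart e (generalAB a β φ)) j i k l u y
      = dyyy j k l (fun y => inChart e (generalAB a β φ) u y * y i) y := by
    rw [dyyy_mul_coord hS hFS hyS]
    rfl
  rw [e1, e2, dyyy_congr (hspray.eventuallyEq_of_mem (hS.mem_nhds hyS)),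
    eqOn_dyyy_add hS h5 (h2.add h3) j k l hyS]
  simp only [eqOn_dyyy_add hS h2 h3 j k l hyS, eqOn_dyyy_const_mul hS h4 _ j k l hyS,
    eqOn_dyyy_const_mul hS h1 _ j k l hyS, eqOn_dyyy_const_mul hS hZ _ j k l hyS, dyyy_qf]
  ring

omit he hu

section ode
variable (τ : M → ℝ) (hτ : HasIsotropicBerwaldCurvature (domainAB a β U) (generalAB a β φ) τ)
include hτ he hu

theorem dyyy_abField_of_isotropic : ∀ y ∈ ratioDomain (metricCoeff a e u) (formCoeff β e u)
    {s | (normForm a β (e.symm u) ^ 2, s) ∈ regularSet φ U}, ∀ i j k l,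
    dyyy j k l (abField (metricCoeff a e u) (formCoeff β e u)
      (raise (metricCoeff a e u) (formCoeff β e u))
      (fun s => Efun φ (normForm a β (e.symm u) ^ 2) s
        - τ (e.symm u) / c (e.symm u) * φ (normForm a β (e.symm u) ^ 2) s)
      (Hfun φ (normForm a β (e.symm u) ^ 2)) i) y = 0 := by
  intro y hy i j k l
  have hy' := (chartVec_mem_iff_mem_ratioDomain a β hU hφ he hu hn hF y).2 hy
  have h := berwald_sub_isotropicTensor a β hU hφ he hu hn hF hc hβ (τ (e.symm u)) hy' j i k l
  rw [hτ e he u hu y hy' j i k l, sub_self] at h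
  exact (mul_eq_zero.1 h.symm).resolve_left (hc _)

/-- At the points with `β ≠ 0`, isotropic Berwald curvature implies the two equations. -/
theorem ode_of_isotropic
    (hU2 : n = 2 → ∀ (x : M) (s : ℝ), |s| ≤ normForm a β x → (normForm a β x ^ 2, s) ∈ U →
      (∀ r ∈ Set.Icc s (normForm a β x), (normForm a β x ^ 2, r) ∈ U) ∨
      (∀ r ∈ Set.Icc (-normForm a β x) s, (normForm a β x ^ 2, r) ∈ U))
    (hb : 0 < normForm a β (e.symm u)) {s : ℝ} (hs : |s| ≤ normForm a β (e.symm u))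
    (hsU : (normForm a β (e.symm u) ^ 2, s) ∈ U) :
    Efun φ (normForm a β (e.symm u) ^ 2) s - s * D2 (Efun φ) (normForm a β (e.symm u) ^ 2) s
        - τ (e.symm u) / c (e.symm u) * (φ (normForm a β (e.symm u) ^ 2) s
          - s * D2 φ (normForm a β (e.symm u) ^ 2) s) = 0 ∧
      D2 (Hfun φ) (normForm a β (e.symm u) ^ 2) s
        - s * D2 (D2 (Hfun φ)) (normForm a β (e.symm u) ^ 2) s = 0 := by
  have hM := metricCoeff_posDef he hu a
  have hreg := fun {r : ℝ} => mem_regularSet_of_abs_le (s := r) a β hU hφ he hu hn hF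
  have hz := dyyy_abField_of_isotropic a β hU hφ he hu hn hF hc hβ τ hτ
  have hsq := normForm_sq he hu a β
  set x := e.symm u
  set t := normForm a β x ^ 2 with ht
  have hrt : √(lf (formCoeff β e u) (raise (metricCoeff a e u) (formCoeff β e u)))
      = normForm a β x := by rw [← hsq, Real.sqrt_sq hb.le]
  have hf := contDiffOn_slice (contDiffOn_Efun hU hφ) t
  have hφV := contDiffOn_slice (hφ.mono fun _ hp => hp.1 : ContDiffOn ℝ ∞ _ (regularSet φ U)) t
  have key := ode_of_dyyy_eq_zero hM (lower_raise_metricCoeff a β he hu)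
    (isOpen_slice (isOpen_regularSet hU hφ) t)
    (hf.sub (contDiffOn_const.mul hφV)) (contDiffOn_slice (contDiffOn_Hfun hU hφ) t) hz hn
    (by rw [← hsq]; positivity)
    (fun h2 r hr hrb => by
      rw [← hsq] at hrb
      have hra : |r| ≤ normForm a β x := abs_le_of_sq_le_sq hrb hb.le
      rw [hrt]
      refine (hU2 h2 x r hra hr.1).imp (fun H q hq => hreg ?_ (H q hq))
        (fun H q hq => hreg ?_ (H q hq))
      · exact abs_le.2 ⟨(abs_le.1 hra).1.trans hq.1, hq.2⟩
      · exact abs_le.2 ⟨hq.1, hq.2.trans (abs_le.1 hra).2⟩)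
    (hreg hs hsU) (by rw [← hsq]; exact sq_le_sq' (abs_le.1 hs).1 (abs_le.1 hs).2)
  rw [deriv_factor hU hφ (hreg hs hsU)] at key
  refine ⟨?_, key.2⟩
  linear_combination key.1

end ode

end

/-! ### The characterization -/

/-- The characterization of isotropic Berwald curvature with a prescribed factor. -/
theorem hasIsotropicBerwaldCurvature_iff {n : ℕ} (hn : 2 ≤ n)
    {M : Type*} [TopologicalSpace M] [ChartedSpace (Coord n) M] [IsManifold (𝓡 n) ∞ M]
    (a : RiemMetric n M) (β : OneForm n M) (c : M → ℝ) (hc : ∀ x, c x ≠ 0)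
    (hβ : ∀ e ∈ IsManifold.maximalAtlas (𝓡 n) ∞ M, ∀ u ∈ e.target, ∀ i j : Fin n,
      covDeriv a β e u i j = c (e.symm u) * metricCoeff a e u i j)
    (U : Set (ℝ × ℝ)) (hU : IsOpen U)
    (φ : ℝ → ℝ → ℝ) (hφ : ContDiffOn ℝ ∞ (Function.uncurry φ) U)
    (hU2 : n = 2 → ∀ (x : M) (s : ℝ), |s| ≤ normForm a β x → (normForm a β x ^ 2, s) ∈ U →
      (∀ r ∈ Set.Icc s (normForm a β x), (normForm a β x ^ 2, r) ∈ U) ∨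
      (∀ r ∈ Set.Icc (-normForm a β x) s, (normForm a β x ^ 2, r) ∈ U))
    (hF : IsFinslerOn (domainAB a β U) (generalAB a β φ)) (τ : M → ℝ) :
    HasIsotropicBerwaldCurvature (domainAB a β U) (generalAB a β φ) τ ↔
      ∀ (x : M) (s : ℝ), |s| ≤ normForm a β x → (normForm a β x ^ 2, s) ∈ U →
        Efun φ (normForm a β x ^ 2) s - s * D2 (Efun φ) (normForm a β x ^ 2) s
            - τ x / c x * (φ (normForm a β x ^ 2) s - s * D2 φ (normForm a β x ^ 2) s) = 0 ∧
        D2 (Hfun φ) (normForm a β x ^ 2) s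
            - s * D2 (D2 (Hfun φ)) (normForm a β x ^ 2) s = 0 := by
  constructor
  · intro hτ x s hs hsU
    obtain ⟨e, he, u, hu, rfl⟩ : ∃ e ∈ IsManifold.maximalAtlas (𝓡 n) ∞ M,
        ∃ u ∈ e.target, e.symm u = x :=
      ⟨chartAt (Coord n) x, IsManifold.chart_mem_maximalAtlas x, chartAt (Coord n) x x,
        (chartAt (Coord n) x).map_source (mem_chart_source _ x),
        (chartAt (Coord n) x).left_inv (mem_chart_source _ x)⟩
    rcases (normForm_nonneg a β (e.symm u)).eq_or_lt with hb | hb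
    swap
    · exact ode_of_isotropic a β hU hφ he hu hn hF hc hβ τ hτ hU2 hb hs hsU
    have hM := metricCoeff_posDef he hu a
    have hsq := normForm_sq he hu a β
    have hreg := mem_regularSet_of_abs_le a β hU hφ he hu hn hF hs hsU
    have hz := dyyy_abField_of_isotropic a β hU hφ he hu hn hF hc hβ τ hτ
    rw [← hb, abs_nonpos_iff] at hs
    subst hs
    have hE := eq_zero_of_dyyy_eq_zero hM (lower_raise_metricCoeff a β he hu)
      (isOpen_slice (isOpen_regularSet hU hφ) _)
      ((contDiffOn_slice (contDiffOn_Efun hU hφ) _).sub (contDiffOn_const.mul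
        (contDiffOn_slice (hφ.mono fun _ hp => hp.1 :
          ContDiffOn ℝ ∞ _ (regularSet φ U)) _)))
      (contDiffOn_slice (contDiffOn_Hfun hU hφ) _) hz hn
      (by rw [← hsq, ← hb]; simp) hreg
    refine ⟨by simpa using hE, ?_⟩
    rw [zero_mul, sub_zero]
    -- at a zero of `β`, the second equation is the limit of the equations at nearby points
    -- with `β ≠ 0`; they exist since `b_{i|j} = c a_{ij}` does not vanish
    by_contra hne
    have hev : (fun w => normForm a β (e.symm w) ^ 2) =ᶠ[nhds u]
        fun w => lf (formCoeff β e w) (raise (metricCoeff a e w) (formCoeff β e w)) := by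
      filter_upwards [e.open_target.mem_nhds hu] with w hw using normForm_sq he hw a β
    have hcont : ContinuousAt (fun w => (normForm a β (e.symm w) ^ 2, (0 : ℝ))) u :=
      (((differentiableAt_normSq (differentiableAt_metricCoeff he hu a)
        (differentiableAt_formCoeff he hu β) hM.det_pos.ne'.isUnit).congr_of_eventuallyEq
          hev).continuousAt).prodMk continuousAt_const
    have hH : ContinuousAt (Function.uncurry (D2 (Hfun φ))) (normForm a β (e.symm u) ^ 2, 0) :=
      (contDiffOn_D2 (isOpen_regularSet hU hφ) (contDiffOn_Hfun hU hφ)).continuousOn.continuousAt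
        ((isOpen_regularSet hU hφ).mem_nhds hreg)
    have hzero : ∀ᶠ w in nhds u, normForm a β (e.symm w) = 0 := by
      have hH' := ContinuousAt.comp (f := fun w => (normForm a β (e.symm w) ^ 2, (0 : ℝ))) hH hcont
      filter_upwards [hH'.eventually_ne hne, hcont.eventually (hU.mem_nhds hsU),
        e.open_target.mem_nhds hu] with w h1 h2 h3
      by_contra h0
      have h4 := (ode_of_isotropic a β hU hφ he h3 hn hF hc hβ τ hτ hU2
        ((normForm_nonneg a β _).lt_of_ne' h0)
        (s := 0) (by rw [abs_zero]; exact normForm_nonneg a β _) h2).2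
      rw [zero_mul, sub_zero] at h4
      exact h1 h4
    have hform : ∀ᶠ w in nhds u, ∀ i, formCoeff β e w i = 0 := by
      filter_upwards [hzero, e.open_target.mem_nhds hu] with w h1 h2 i
      have h3 := sq_lf_le (metricCoeff_posDef he h2 a) (lower_raise_metricCoeff a β he h2)
        (EuclideanSpace.single i 1)
      rw [← normForm_sq he h2, h1] at h3
      have h4 : lf (formCoeff β e w) (EuclideanSpace.single i 1) = formCoeff β e w i := by
        simp [lf]
      rw [h4] at h3
      exact pow_eq_zero_iff two_ne_zero |>.1 (le_antisymm (by simpa using h3) (sq_nonneg _))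
    let i0 : Fin n := ⟨0, by omega⟩
    have h1 := hβ e he u hu i0 i0
    have h2 : (fun w => formCoeff β e w i0) =ᶠ[nhds u] fun _ => 0 := hform.mono fun w h => h i0
    rw [covDeriv, h2.fderiv_eq] at h1
    simp [hform.self_of_nhds, hc, (hM.diag_pos (i := i0)).ne'] at h1
  · intro H e he u hu y hy j i k l
    have hM := metricCoeff_posDef he hu a
    have hy' := (chartVec_mem_iff_mem_ratioDomain a β hU hφ he hu hn hF y).1 hy
    have hsq := normForm_sq he hu a β
    have habs : ∀ s, s ^ 2 ≤ lf (formCoeff β e u) (raise (metricCoeff a e u) (formCoeff β e u)) →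
        |s| ≤ normForm a β (e.symm u) := fun s hs =>
      abs_le_of_sq_le_sq (by rwa [hsq]) (normForm_nonneg a β _)
    rw [← sub_eq_zero, berwald_sub_isotropicTensor a β hU hφ he hu hn hF hc hβ _ hy j i k l]
    rw [dyyy_abField_eq_zero hM (isOpen_slice (isOpen_regularSet hU hφ) _)
      ((contDiffOn_slice (contDiffOn_Efun hU hφ) _).sub (contDiffOn_const.mul
        (contDiffOn_slice (hφ.mono fun _ hp => hp.1 :
          ContDiffOn ℝ ∞ _ (regularSet φ U)) _)))
      (contDiffOn_slice (contDiffOn_Hfun hU hφ) _) (lower_raise_metricCoeff a β he hu)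
      (fun s hs hsb => by
        rw [deriv_factor hU hφ hs]
        linear_combination (H (e.symm u) s (habs s hsb) hs.1).1)
      (fun s hs hsb => (H (e.symm u) s (habs s hsb) hs.1).2) hy' i j k l, mul_zero]

end GeneralAB

end

theorem mainTheorem2 {n : ℕ} (hn : 2 ≤ n)
    {M : Type*} [TopologicalSpace M] [ChartedSpace (GeneralAB.Coord n) M] [IsManifold (𝓡 n) ∞ M]
    (a : GeneralAB.RiemMetric n M) (β : GeneralAB.OneForm n M)
    (c : M → ℝ) (hc : ∀ x, c x ≠ 0)
    (hβ : ∀ e ∈ IsManifold.maximalAtlas (𝓡 n) ∞ M, ∀ u ∈ e.target, ∀ i j : Fin n,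
      GeneralAB.covDeriv a β e u i j = c (e.symm u) * GeneralAB.metricCoeff a e u i j)
    (U : Set (ℝ × ℝ)) (hU : IsOpen U)
    (φ : ℝ → ℝ → ℝ) (hφ : ContDiffOn ℝ ∞ (Function.uncurry φ) U)
    -- in dimension two, the domain of `φ(b², ·)` reaches `b` or `-b` from each of its points
    (hU2 : n = 2 → ∀ (x : M) (s : ℝ), |s| ≤ GeneralAB.normForm a β x →
      (GeneralAB.normForm a β x ^ 2, s) ∈ U →
      (∀ r ∈ Set.Icc s (GeneralAB.normForm a β x), (GeneralAB.normForm a β x ^ 2, r) ∈ U) ∨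
      (∀ r ∈ Set.Icc (-GeneralAB.normForm a β x) s, (GeneralAB.normForm a β x ^ 2, r) ∈ U))
    (hF : GeneralAB.IsFinslerOn (GeneralAB.domainAB a β U) (GeneralAB.generalAB a β φ)) :
    (∀ τ : M → ℝ,
      GeneralAB.HasIsotropicBerwaldCurvature (GeneralAB.domainAB a β U)
          (GeneralAB.generalAB a β φ) τ ↔
        ∀ (x : M) (s : ℝ), |s| ≤ GeneralAB.normForm a β x →
          (GeneralAB.normForm a β x ^ 2, s) ∈ U →
          GeneralAB.Efun φ (GeneralAB.normForm a β x ^ 2) s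
              - s * GeneralAB.D2 (GeneralAB.Efun φ) (GeneralAB.normForm a β x ^ 2) s
              - τ x / c x * (φ (GeneralAB.normForm a β x ^ 2) s
                - s * GeneralAB.D2 φ (GeneralAB.normForm a β x ^ 2) s) = 0 ∧
          GeneralAB.D2 (GeneralAB.Hfun φ) (GeneralAB.normForm a β x ^ 2) s
              - s * GeneralAB.D2 (GeneralAB.D2 (GeneralAB.Hfun φ))
                (GeneralAB.normForm a β x ^ 2) s = 0) ∧
    (GeneralAB.IsBerwald (GeneralAB.domainAB a β U) (GeneralAB.generalAB a β φ) ↔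
      ∀ (x : M) (s : ℝ), |s| ≤ GeneralAB.normForm a β x →
        (GeneralAB.normForm a β x ^ 2, s) ∈ U →
        GeneralAB.Efun φ (GeneralAB.normForm a β x ^ 2) s
            - s * GeneralAB.D2 (GeneralAB.Efun φ) (GeneralAB.normForm a β x ^ 2) s = 0 ∧
        GeneralAB.D2 (GeneralAB.Hfun φ) (GeneralAB.normForm a β x ^ 2) s
            - s * GeneralAB.D2 (GeneralAB.D2 (GeneralAB.Hfun φ))
              (GeneralAB.normForm a β x ^ 2) s = 0) := by
  have main := GeneralAB.hasIsotropicBerwaldCurvature_iff hn a β c hc hβ U hU φ hφ hU2 hF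
  refine ⟨main, ?_⟩
  -- Berwald metrics are the case `τ = 0`
  have h0 := main fun _ => 0
  simp only [zero_div, zero_mul, sub_zero] at h0
  rw [← h0]
  simp only [GeneralAB.IsBerwald, GeneralAB.HasIsotropicBerwaldCurvature, zero_mul]
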